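/- Let $J$ be a constant antisymmetric real $m\times m$ matrix and let $H\colon\mathbb{R}^m\to\mathbb{R}$ be smooth ($C^\infty$). Consider the generalized Hamiltonian system $$J\dot z=\nabla H(z),\qquad z\in\mathbb{R}^m. \tag{1}$$ Let $z=S(q,p,\lambda)$, with $q,p\in\mathbb{R}^n$, $\lambda\in\mathbb{R}^k$, be linear Darboux coordinates for $J$, i.e. $S$ is a linear isomorphism with $$S^TJS=\begin{pmatrix}0&-I&0\\ I&0&0\\0&0&0\end{pmatrix},$$ so that (1) reads $-\dot p=H_q$, $\dot q=H_p$, $0=H_\lambda$. Suppose that (1) has index 1 in the following sense: for all $q,p$ the equation $H_\lambda(q,p,\lambda)=0$ has a unique solution $\lambda=\tilde\lambda(q,p)$, and $\tilde\lambda$ is a smooth function of $(q,p)$. Let $C=\{z: H_\lambda=0\}$ be the constraint submanifold. Let $(a_{ij}),(b_j)$ be the coefficients of an $s$-stage symplectic Runge–Kutta method, i.e. $b_ib_j-b_ja_{ji}-b_ia_{ij}=0$ for all $i,j$. Applied to (1) with step size $h$ at $z_0\in C$ it consists of the equations $$JZ_i=Jz_0+h\sum_j a_{ij}JF_j,\qquad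 Jz_1=Jz_0+h\sum_j b_jJF_j,\qquad JF_j=\nabla H(Z_j),$$ together with $z_1\in C$, which fixes the $\lambda$-component of $z_1$ that is otherwise arbitrary. Then the following hold. 1. (Well-definedness, constraint, symplectic form.) For every compact $K\subseteq C$ and every $\rho>0$ there are $h_0>0$, an open set $U\supseteq K$, and maps $\Psi_h$ such that for all $|h|\le h_0$ and all $z_0\in C\cap U$: the equations of the method have exactly one solution $(Z_1,\dots,Z_s,z_1)$ with $\|Z_i-z_0\|\le\rho$ for all $i$; it has $z_1=\Psi_h(z_0)\in C$ and $Z_i\in C$ for all $i$; and $\Psi_h|_C$ is differentiable at $z_0$ and preserves the form $dq\wedge dp$ on $C$: $(dq\wedge dp)(D\Psi_h(z_0)v,D\Psi_h(z_0)w)=(dq\wedge dp)(v,w)$ for all $v,w\in T_{z_0}C$. 2. (Convergence.) Suppose that the method has order $r\ge1$, i.e. for every smooth ordinary differential equation $\dot y=f(y)$ on $\mathbb{R}^d$, $d\ge0$, and every solution $y$ of it starting at time $0$, the numerical step of size $h>0$ from $y(0)$ (with stages close to $y(0)$) ends within $O(h^{r+1})$ of $y(h)$ as $h\to0$. Then for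 every $T>0$ and every solution $z\colon[0,T]\to\mathbb{R}^m$ of (1) there is a constant $c$ such that for every $\rho>0$ there is $h_0>0$ such that for all $0<h\le h_0$ and all $N\in\mathbb{N}$ with $Nh\le T$: there are $\zeta_0=z(0),\zeta_1,\dots,\zeta_N$ obtained by $N$ successive steps of the method with step size $h$ and with the stages of each step within distance $\rho$ of its starting point, and all such sequences satisfy $\|\zeta_j-z(jh)\|\le c\,h^r$ for $0\le j\le N$. -/

import Mathlib

open scoped ContDiff

/-- Action of a real square matrix `J` on a vector of Euclidean space `ℝ^m`. -/
noncomputable def matApply {m : ℕ} (J : Matrix (Fin m) (Fin m) ℝ)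
    (v : EuclideanSpace ℝ (Fin m)) : EuclideanSpace ℝ (Fin m) :=
  WithLp.toLp 2 (J.mulVec v.ofLp)

/-- The coordinate space of triples `(q, p, λ)` with `q, p ∈ ℝ^n` and `λ ∈ ℝ^k`. -/
abbrev DarbouxSpace (n k : ℕ) : Type :=
  EuclideanSpace ℝ (Fin n) × EuclideanSpace ℝ (Fin n) × EuclideanSpace ℝ (Fin k)

/-- The two-form `dq ∧ dp` on the space of triples `(q, p, λ)`. -/
noncomputable def dqdp {n k : ℕ} (v w : DarbouxSpace n k) : ℝ :=
  inner ℝ v.1 w.2.1 - inner ℝ v.2.1 w.1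

/-- Linear Darboux coordinates `z = S (q, p, λ)` for a constant antisymmetric matrix `J`:
the matrix `Sᵀ J S` is the block matrix with rows `(0, -1, 0)`, `(1, 0, 0)`, `(0, 0, 0)`.
In these coordinates `J ż = ∇H(z)` reads `-ṗ = H_q`, `q̇ = H_p`, `0 = H_λ`. -/
structure DarbouxCoordinates {m : ℕ} (J : Matrix (Fin m) (Fin m) ℝ) (n k : ℕ) where
  /-- the linear change of coordinates `S` -/
  S : DarbouxSpace n k ≃L[ℝ] EuclideanSpace ℝ (Fin m)
  form_eq : ∀ v w : DarbouxSpace n k,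
    inner ℝ (S v) (matApply J (S w)) = inner ℝ v.2.1 w.1 - inner ℝ v.1 w.2.1

namespace DarbouxCoordinates

variable {m n k : ℕ} {J : Matrix (Fin m) (Fin m) ℝ}

/-- The partial gradient `H_λ(q, p, λ)` of the Hamiltonian in Darboux coordinates. -/
noncomputable def gradLam (D : DarbouxCoordinates J n k) (H : EuclideanSpace ℝ (Fin m) → ℝ)
    (q p : EuclideanSpace ℝ (Fin n)) (l : EuclideanSpace ℝ (Fin k)) :
    EuclideanSpace ℝ (Fin k) :=
  gradient (fun l' => H (D.S (q, p, l'))) l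

/-- Index one: for all `q, p` the constraint `H_λ(q, p, λ) = 0` has exactly one solution
`λ = lam (q, p)`, and this solution depends smoothly on `(q, p)`. -/
def IndexOne (D : DarbouxCoordinates J n k) (H : EuclideanSpace ℝ (Fin m) → ℝ) : Prop :=
  ∃ lam : EuclideanSpace ℝ (Fin n) × EuclideanSpace ℝ (Fin n) → EuclideanSpace ℝ (Fin k),
    ContDiff ℝ ∞ lam ∧ ∀ q p l, D.gradLam H q p l = 0 ↔ l = lam (q, p)

/-- The constraint submanifold `H_λ = 0`, as a subset of the phase space `ℝ^m`. -/
def constraintSet (D : DarbouxCoordinates J n k) (H : EuclideanSpace ℝ (Fin m) → ℝ) :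
    Set (EuclideanSpace ℝ (Fin m)) :=
  {z | D.gradLam H (D.S.symm z).1 (D.S.symm z).2.1 (D.S.symm z).2.2 = 0}

/-- The two-form `dq ∧ dp` on the phase space `ℝ^m`. -/
noncomputable def form (D : DarbouxCoordinates J n k) (v w : EuclideanSpace ℝ (Fin m)) : ℝ :=
  dqdp (D.S.symm v) (D.S.symm w)

end DarbouxCoordinates

/-- `z` solves `J ż = ∇H(z)` on the interval `[0, T]`. -/
def IsExactSolution {m : ℕ} (J : Matrix (Fin m) (Fin m) ℝ) (H : EuclideanSpace ℝ (Fin m) → ℝ)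
    (T : ℝ) (z : ℝ → EuclideanSpace ℝ (Fin m)) : Prop :=
  ∀ t ∈ Set.Icc 0 T, ∃ v : EuclideanSpace ℝ (Fin m),
    HasDerivWithinAt z v (Set.Icc 0 T) t ∧ matApply J v = gradient H (z t)

/-- The coefficients `a i j`, `b j` of a Runge-Kutta method with `s` stages. -/
structure RungeKutta (s : ℕ) where
  a : Fin s → Fin s → ℝ
  b : Fin s → ℝ

namespace RungeKutta

variable {s : ℕ}

/-- The coefficient condition of a symplectic Runge-Kutta method. -/
def IsSymplectic (M : RungeKutta s) : Prop :=
  ∀ i j, M.b i * M.b j - M.b j * M.a j i - M.b i * M.a i j = 0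

/-- One step `y₀ ↦ y₁` of size `h`, with stages `Y i`, for the ordinary differential
equation `ẏ = f(y)`. -/
def IsODEStep (M : RungeKutta s) {d : ℕ}
    (f : EuclideanSpace ℝ (Fin d) → EuclideanSpace ℝ (Fin d)) (h : ℝ)
    (y₀ : EuclideanSpace ℝ (Fin d)) (Y : Fin s → EuclideanSpace ℝ (Fin d))
    (y₁ : EuclideanSpace ℝ (Fin d)) : Prop :=
  (∀ i, Y i = y₀ + h • ∑ j, M.a i j • f (Y j)) ∧ y₁ = y₀ + h • ∑ j, M.b j • f (Y j)

/-- The method has order (at least) `r`: for every smooth ordinary differential equation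
`ẏ = f(y)` and every solution `y`, the error after one step of size `h` from `y 0` is
`O(h ^ (r + 1))`. The stage equations being implicit, the numerical step meant is the one
whose stages are close to the initial value. -/
def HasOrder (M : RungeKutta s) (r : ℕ) : Prop :=
  ∀ (d : ℕ) (f : EuclideanSpace ℝ (Fin d) → EuclideanSpace ℝ (Fin d)), ContDiff ℝ ∞ f →
    ∀ (T : ℝ) (y : ℝ → EuclideanSpace ℝ (Fin d)), 0 < T →
      (∀ t ∈ Set.Icc 0 T, HasDerivWithinAt y (f (y t)) (Set.Icc 0 T) t) →
      ∃ c : ℝ, ∃ ρ > 0, ∃ h₀ > 0, ∀ h : ℝ, 0 < h → h ≤ h₀ → h ≤ T →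
        ∀ Y y₁, M.IsODEStep f h (y 0) Y y₁ → (∀ i, ‖Y i - y 0‖ ≤ ρ) →
          ‖y₁ - y h‖ ≤ c * h ^ (r + 1)

/-- The Runge-Kutta equations for `J ż = ∇H(z)`, with stages `Z i` and step size `h`. -/
def IsStep (M : RungeKutta s) {m : ℕ} (J : Matrix (Fin m) (Fin m) ℝ)
    (H : EuclideanSpace ℝ (Fin m) → ℝ) (h : ℝ) (z₀ : EuclideanSpace ℝ (Fin m))
    (Z : Fin s → EuclideanSpace ℝ (Fin m)) (z₁ : EuclideanSpace ℝ (Fin m)) : Prop :=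
  ∃ F : Fin s → EuclideanSpace ℝ (Fin m),
    (∀ i, matApply J (Z i) = matApply J z₀ + h • ∑ j, M.a i j • matApply J (F j)) ∧
    matApply J z₁ = matApply J z₀ + h • ∑ j, M.b j • matApply J (F j) ∧
    ∀ j, matApply J (F j) = gradient H (Z j)

/-- A step of the method with stages within distance `ρ` of `z₀`. The Runge-Kutta equations
leave the `λ`-component of `z₁` free; it is fixed by requiring `H_λ(z₁) = 0`. -/
def IsConstrainedStep (M : RungeKutta s) {m n k : ℕ} {J : Matrix (Fin m) (Fin m) ℝ}
    (D : DarbouxCoordinates J n k) (H : EuclideanSpace ℝ (Fin m) → ℝ) (ρ h : ℝ)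
    (z₀ : EuclideanSpace ℝ (Fin m)) (Z : Fin s → EuclideanSpace ℝ (Fin m))
    (z₁ : EuclideanSpace ℝ (Fin m)) : Prop :=
  M.IsStep J H h z₀ Z z₁ ∧ (∀ i, ‖Z i - z₀‖ ≤ ρ) ∧ z₁ ∈ D.constraintSet H

/-- `ζ 0, …, ζ N` is obtained by `N` successive steps of size `h`. -/
def IsTrajectory (M : RungeKutta s) {m n k : ℕ} {J : Matrix (Fin m) (Fin m) ℝ}
    (D : DarbouxCoordinates J n k) (H : EuclideanSpace ℝ (Fin m) → ℝ) (ρ h : ℝ) (N : ℕ)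
    (ζ : ℕ → EuclideanSpace ℝ (Fin m)) : Prop :=
  ∀ j < N, ∃ Z, M.IsConstrainedStep D H ρ h (ζ j) Z (ζ (j + 1))

end RungeKutta

section FixedPoint

open Filter Topology

/-- A fixed point of a smooth parametrised contraction depends smoothly on the parameter. -/
theorem contDiffAt_of_eventually_fixedPoint {X V : Type*} [NormedAddCommGroup X]
    [NormedSpace ℝ X] [CompleteSpace X] [NormedAddCommGroup V] [NormedSpace ℝ V] [CompleteSpace V]
    {n : ℕ∞ω} (hn : n ≠ 0) {F : X × V → V} {x₀ : X} {Y : X → V} {K : NNReal} (hK : K < 1)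
    (hF : ContDiffAt ℝ n F (x₀, Y x₀))
    (hlip : ∀ᶠ x in 𝓝 x₀, LipschitzWith K fun v => F (x, v))
    (hY : ∀ᶠ x in 𝓝 x₀, F (x, Y x) = Y x) : ContDiffAt ℝ n Y x₀ := by
  set G : X × V → V := fun u => u.2 - F u
  have hG : ContDiffAt ℝ n G (x₀, Y x₀) := contDiffAt_snd.sub hF
  have hFd : HasFDerivAt F (fderiv ℝ F (x₀, Y x₀)) (x₀, Y x₀) :=
    (hF.differentiableAt hn).hasFDerivAt
  have hpart : HasFDerivAt (fun v => F (x₀, v))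
      (fderiv ℝ F (x₀, Y x₀) ∘L .inr ℝ X V) (Y x₀) :=
    HasFDerivAt.comp (Y x₀) (f := fun v => (x₀, v)) hFd (hasFDerivAt_prodMk_right x₀ (Y x₀))
  have hnorm : ‖fderiv ℝ F (x₀, Y x₀) ∘L .inr ℝ X V‖ < 1 := by
    rw [← hpart.fderiv]
    exact (norm_fderiv_le_of_lipschitz ℝ hlip.self_of_nhds).trans_lt (by exact_mod_cast hK)
  have hGd : fderiv ℝ G (x₀, Y x₀) ∘L .inr ℝ X V =
      1 - fderiv ℝ F (x₀, Y x₀) ∘L .inr ℝ X V := by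
    have : HasFDerivAt G (.snd ℝ X V - fderiv ℝ F (x₀, Y x₀)) (x₀, Y x₀) :=
      hasFDerivAt_snd.sub hFd
    rw [this.fderiv]
    ext v
    simp
  have hinv : (fderiv ℝ G (x₀, Y x₀) ∘L .inr ℝ X V).IsInvertible := by
    rw [hGd]
    obtain ⟨u, hu⟩ := isUnit_one_sub_of_norm_lt_one hnorm
    exact ⟨ContinuousLinearEquiv.unitsEquiv ℝ V u, by ext v; simp [← hu]⟩
  have hG0 : G (x₀, Y x₀) = 0 := by simp [G, hY.self_of_nhds]
  refine (hG.contDiffAt_implicitFunction hn hinv).congr_of_eventuallyEq ?_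
  filter_upwards [hY, hlip, hG.eventually_apply_implicitFunction hn hinv] with x h1 h2 h3
  rw [hG0, sub_eq_zero] at h3
  have h4 := h2.dist_le_mul (Y x) (hG.implicitFunction hn hinv x)
  rw [h1, ← h3] at h4
  have hK' : (K : ℝ) < 1 := by exact_mod_cast hK
  exact dist_le_zero.1 (by nlinarith [dist_nonneg (x := Y x) (y := hG.implicitFunction hn hinv x)])

end FixedPoint

namespace RungeKutta

section Stages

variable {s : ℕ} {E : Type*} [NormedAddCommGroup E] [NormedSpace ℝ E]

/-- The right-hand side of the stage equations for `ẏ = g(y)`. -/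
def stageMap (M : RungeKutta s) (g : E → E) (h : ℝ) (y₀ : E) (Y : Fin s → E) : Fin s → E :=
  fun i => y₀ + h • ∑ j, M.a i j • g (Y j)

/-- The end point of a step for `ẏ = g(y)` with given stages. -/
def endpoint (M : RungeKutta s) (g : E → E) (h : ℝ) (y₀ : E) (Y : Fin s → E) : E :=
  y₀ + h • ∑ j, M.b j • g (Y j)

/-- A bound for the coefficients of the method. -/
noncomputable def coeffBound (M : RungeKutta s) : NNReal :=
  ∑ i, ∑ j, ‖M.a i j‖₊ + ∑ j, ‖M.b j‖₊

theorem sum_norm_a_le (M : RungeKutta s) (i : Fin s) : ∑ j, ‖M.a i j‖ ≤ M.coeffBound := by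
  have : ∑ j, ‖M.a i j‖₊ ≤ M.coeffBound :=
    (Finset.single_le_sum (f := fun i => ∑ j, ‖M.a i j‖₊) (fun _ _ => zero_le)
      (Finset.mem_univ i)).trans le_self_add
  simpa using NNReal.coe_le_coe.2 this

theorem sum_norm_b_le (M : RungeKutta s) : ∑ j, ‖M.b j‖ ≤ M.coeffBound := by
  have : ∑ j, ‖M.b j‖₊ ≤ M.coeffBound := le_add_self
  simpa using NNReal.coe_le_coe.2 this

theorem norm_sum_smul_le {ι : Type*} [Fintype ι] {c : ι → ℝ} {α B : ℝ} (hc : ∑ j, ‖c j‖ ≤ α)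
    (hB0 : 0 ≤ B) {u : ι → E} (hu : ∀ j, ‖u j‖ ≤ B) : ‖∑ j, c j • u j‖ ≤ α * B := by
  calc ‖∑ j, c j • u j‖ ≤ ∑ j, ‖c j • u j‖ := norm_sum_le _ _
    _ ≤ ∑ j, ‖c j‖ * B := by
        gcongr with j
        rw [norm_smul]
        gcongr
        exact hu j
    _ = (∑ j, ‖c j‖) * B := by rw [Finset.sum_mul]
    _ ≤ α * B := by gcongr

theorem norm_stageMap_sub_le (M : RungeKutta s) {g : E → E} {B : Set E} {L : NNReal}
    (hg : LipschitzOnWith L g B) {h : ℝ} {y y' : E} {Y Y' : Fin s → E}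
    (hY : ∀ i, Y i ∈ B) (hY' : ∀ i, Y' i ∈ B) :
    ‖M.stageMap g h y Y - M.stageMap g h y' Y'‖ ≤
      ‖y - y'‖ + |h| * (M.coeffBound * (L * ‖Y - Y'‖)) := by
  refine (pi_norm_le_iff_of_nonneg (by positivity)).2 fun i => ?_
  have : (M.stageMap g h y Y - M.stageMap g h y' Y') i =
      (y - y') + h • ∑ j, M.a i j • (g (Y j) - g (Y' j)) := by
    simp only [stageMap, Pi.sub_apply, smul_sub, Finset.sum_sub_distrib]
    abel
  rw [this]
  refine (norm_add_le _ _).trans ?_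
  rw [norm_smul, Real.norm_eq_abs]
  gcongr
  refine norm_sum_smul_le (M.sum_norm_a_le i) (by positivity) fun j => ?_
  refine (hg.norm_sub_le (hY j) (hY' j)).trans ?_
  gcongr
  exact norm_le_pi_norm (Y - Y') j

theorem norm_endpoint_sub_le (M : RungeKutta s) {g : E → E} {B : Set E} {L : NNReal}
    (hg : LipschitzOnWith L g B) {h : ℝ} {y y' : E} {Y Y' : Fin s → E}
    (hY : ∀ i, Y i ∈ B) (hY' : ∀ i, Y' i ∈ B) :
    ‖M.endpoint g h y Y - M.endpoint g h y' Y'‖ ≤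
      ‖y - y'‖ + |h| * (M.coeffBound * (L * ‖Y - Y'‖)) := by
  have : M.endpoint g h y Y - M.endpoint g h y' Y' =
      (y - y') + h • ∑ j, M.b j • (g (Y j) - g (Y' j)) := by
    simp only [endpoint, smul_sub, Finset.sum_sub_distrib]
    abel
  rw [this]
  refine (norm_add_le _ _).trans ?_
  rw [norm_smul, Real.norm_eq_abs]
  gcongr
  refine norm_sum_smul_le M.sum_norm_b_le (by positivity) fun j => ?_
  refine (hg.norm_sub_le (hY j) (hY' j)).trans ?_
  gcongr
  exact norm_le_pi_norm (Y - Y') j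

/-- Solutions of the stage equations depend Lipschitz-continuously on the initial value. -/
theorem norm_stages_sub_le (M : RungeKutta s) {g : E → E} {B : Set E} {L : NNReal}
    (hg : LipschitzOnWith L g B) {h : ℝ} (hh : |h| * (M.coeffBound * L) ≤ 1 / 2)
    {y y' : E} {Y Y' : Fin s → E} (hY : ∀ i, Y i ∈ B) (hY' : ∀ i, Y' i ∈ B)
    (e : Y = M.stageMap g h y Y) (e' : Y' = M.stageMap g h y' Y') :
    ‖Y - Y'‖ ≤ 2 * ‖y - y'‖ := by
  have h1 := M.norm_stageMap_sub_le hg (h := h) (y := y) (y' := y') hY hY'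
  rw [← e, ← e'] at h1
  have h2 : |h| * (M.coeffBound * (L * ‖Y - Y'‖)) ≤ 1 / 2 * ‖Y - Y'‖ := by
    rw [← mul_assoc (M.coeffBound : ℝ), ← mul_assoc]
    gcongr
  linarith

/-- Small solutions of the stage equations are unique. -/
theorem stages_unique (M : RungeKutta s) {g : E → E} {B : Set E} {L : NNReal}
    (hg : LipschitzOnWith L g B) {h : ℝ} (hh : |h| * (M.coeffBound * L) ≤ 1 / 2)
    {y : E} {Y Y' : Fin s → E} (hY : ∀ i, Y i ∈ B) (hY' : ∀ i, Y' i ∈ B)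
    (e : Y = M.stageMap g h y Y) (e' : Y' = M.stageMap g h y Y') : Y = Y' := by
  have := M.norm_stages_sub_le hg hh hY hY' e e'
  rw [sub_self, norm_zero, mul_zero] at this
  exact sub_eq_zero.1 (norm_le_zero_iff.1 this)

theorem lipschitzWith_stageMap (M : RungeKutta s) {g : E → E} {L : NNReal}
    (hg : LipschitzWith L g) {h : ℝ} (hh : |h| * (M.coeffBound * L) ≤ 1 / 2) (y : E) :
    LipschitzWith (1 / 2) (M.stageMap g h y) := by
  refine LipschitzWith.of_dist_le_mul fun Y Y' => ?_
  rw [dist_eq_norm, dist_eq_norm]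
  have h1 := M.norm_stageMap_sub_le (hg.lipschitzOnWith (s := Set.univ)) (h := h) (y := y) (y' := y)
    (Y := Y) (Y' := Y') (by simp) (by simp)
  rw [sub_self, norm_zero, zero_add, ← mul_assoc (M.coeffBound : ℝ), ← mul_assoc] at h1
  refine h1.trans ?_
  push_cast
  gcongr

theorem norm_stageMap_sub_const_le (M : RungeKutta s) {g : E → E} {C : ℝ} (hC0 : 0 ≤ C) {h : ℝ}
    (y : E) {Y : Fin s → E} (hC : ∀ j, ‖g (Y j)‖ ≤ C) (i : Fin s) :
    ‖M.stageMap g h y Y i - y‖ ≤ |h| * (M.coeffBound * C) := by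
  rw [stageMap, add_sub_cancel_left, norm_smul, Real.norm_eq_abs]
  gcongr
  exact norm_sum_smul_le (M.sum_norm_a_le i) hC0 hC

/-- A smooth family of solutions of the stage equations for a bounded, Lipschitz field. -/
theorem exists_stages [CompleteSpace E] (M : RungeKutta s) {g : E → E} {L : NNReal}
    (hg : LipschitzWith L g) (hgs : ContDiff ℝ ∞ g) :
    ∃ Y : ℝ × E → Fin s → E,
      (∀ x : ℝ × E, |x.1| * (M.coeffBound * L) ≤ 1 / 2 → Y x = M.stageMap g x.1 x.2 (Y x)) ∧
      ∀ x : ℝ × E, |x.1| * (M.coeffBound * L) < 1 / 2 → ContDiffAt ℝ ∞ Y x := by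
  classical
  have hex : ∀ x : ℝ × E, |x.1| * (M.coeffBound * L) ≤ 1 / 2 →
      ∃ Y, Y = M.stageMap g x.1 x.2 Y := fun x hx => by
    have hc : ContractingWith (1 / 2) (M.stageMap g x.1 x.2) :=
      ⟨by rw [← NNReal.coe_lt_coe]; push_cast; norm_num, M.lipschitzWith_stageMap hg hx x.2⟩
    exact ⟨hc.fixedPoint, hc.fixedPoint_isFixedPt.symm⟩
  choose! Y hY using hex
  refine ⟨Y, hY, fun x hx => ?_⟩
  have hnear : ∀ᶠ x' : ℝ × E in nhds x, |x'.1| * (M.coeffBound * L) < 1 / 2 :=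
    (Continuous.continuousAt (by fun_prop)).eventually_lt continuousAt_const hx
  refine contDiffAt_of_eventually_fixedPoint (K := 1 / 2) (by simp)
    (F := fun u : (ℝ × E) × (Fin s → E) => M.stageMap g u.1.1 u.1.2 u.2)
    (by rw [← NNReal.coe_lt_coe]; push_cast; norm_num) ?_ ?_ ?_
  · apply ContDiff.contDiffAt
    unfold stageMap
    fun_prop
  · filter_upwards [hnear] with x' hx'
    exact M.lipschitzWith_stageMap hg hx'.le x'.2
  · filter_upwards [hnear] with x' hx'
    exact (hY x' hx'.le).symm

end Stages

end RungeKutta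

section Taylor

open Set Filter Topology

variable {E V : Type*} [NormedAddCommGroup E] [NormedSpace ℝ E] [NormedAddCommGroup V]
  [NormedSpace ℝ V]

/-- A polynomial of degree at most `r` that is `O(h ^ (r + 1))` as `h → 0+` vanishes. -/
theorem coeff_eq_zero_of_norm_sum_le {r : ℕ} {p : ℕ → E} {C δ : ℝ} (hδ : 0 < δ)
    (hp : ∀ h ∈ Ioo 0 δ, ‖∑ k ∈ Finset.range (r + 1), h ^ k • p k‖ ≤ C * h ^ (r + 1)) :
    ∀ k ∈ Finset.range (r + 1), p k = 0 := by
  have hmem : Ioo 0 δ ∈ 𝓝[>] (0 : ℝ) := Ioo_mem_nhdsGT hδ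
  have key : ∀ (r : ℕ) (p : ℕ → E),
      (∀ h ∈ Ioo 0 δ, ‖∑ k ∈ Finset.range (r + 1), h ^ k • p k‖ ≤ C * h ^ (r + 1)) → p 0 = 0 := by
    intro r p hp
    have h1 : Tendsto (fun h : ℝ => ∑ k ∈ Finset.range (r + 1), h ^ k • p k) (𝓝[>] 0) (𝓝 (p 0)) := by
      have : Continuous (fun h : ℝ => ∑ k ∈ Finset.range (r + 1), h ^ k • p k) := by fun_prop
      have h2 := (this.tendsto 0).mono_left (nhdsWithin_le_nhds (s := Ioi 0))
      simpa [Finset.sum_range_succ'] using h2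
    have h3 : Tendsto (fun h : ℝ => C * h ^ (r + 1)) (𝓝[>] 0) (𝓝 0) := by
      have : Continuous (fun h : ℝ => C * h ^ (r + 1)) := by fun_prop
      simpa using (this.tendsto 0).mono_left (nhdsWithin_le_nhds (s := Ioi 0))
    refine tendsto_nhds_unique h1 (squeeze_zero_norm' ?_ h3)
    filter_upwards [hmem] with h hh using hp h hh
  induction r generalizing p with
  | zero =>
    intro k hk
    obtain rfl : k = 0 := by simpa using hk
    exact key 0 p hp
  | succ r ih =>
    have h0 : p 0 = 0 := key (r + 1) p hp
    have hshift := ih (p := fun k => p (k + 1)) fun h hh => by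
      have h1 := hp h hh
      rw [Finset.sum_range_succ', h0, smul_zero, add_zero] at h1
      have h2 : ∑ k ∈ Finset.range (r + 1), h ^ (k + 1) • p (k + 1) =
          h • ∑ k ∈ Finset.range (r + 1), h ^ k • p (k + 1) := by
        rw [Finset.smul_sum]
        exact Finset.sum_congr rfl fun k _ => by rw [smul_smul, pow_succ']
      rw [h2, norm_smul, Real.norm_of_nonneg hh.1.le, pow_succ'] at h1
      exact le_of_mul_le_mul_left (by linarith) hh.1
    intro k hk
    cases k with
    | zero => exact h0
    | succ k => exact hshift k (by simpa using hk)

/-- If two functions with Taylor expansions of order `r` differ by `O(h ^ (r + 1))` as `h → 0+`,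
then the difference is bounded by the sum of the remainders. -/
theorem norm_sub_le_of_taylor {r : ℕ} {a b : ℝ → E} {p q : ℕ → E} {A B C δ δ' : ℝ}
    (hδ' : 0 < δ')
    (ha : ∀ h ∈ Ioc 0 δ, ‖a h - ∑ k ∈ Finset.range (r + 1), h ^ k • p k‖ ≤ A * h ^ (r + 1))
    (hb : ∀ h ∈ Ioc 0 δ, ‖b h - ∑ k ∈ Finset.range (r + 1), h ^ k • q k‖ ≤ B * h ^ (r + 1))
    (hab : ∀ h ∈ Ioc 0 δ', ‖a h - b h‖ ≤ C * h ^ (r + 1)) :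
    ∀ h ∈ Ioc 0 δ, ‖a h - b h‖ ≤ (A + B) * h ^ (r + 1) := by
  intro h hh
  have hδ : 0 < δ := hh.1.trans_le hh.2
  have hpq := coeff_eq_zero_of_norm_sum_le (r := r) (p := fun k => p k - q k) (C := A + B + C)
    (lt_min hδ hδ') fun x hx => by
      have hx1 : x ∈ Ioc 0 δ := ⟨hx.1, (hx.2.trans_le (min_le_left _ _)).le⟩
      have hx2 : x ∈ Ioc 0 δ' := ⟨hx.1, (hx.2.trans_le (min_le_right _ _)).le⟩
      have e : ∑ k ∈ Finset.range (r + 1), x ^ k • (p k - q k) =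
          (b x - ∑ k ∈ Finset.range (r + 1), x ^ k • q k) + (a x - b x)
            - (a x - ∑ k ∈ Finset.range (r + 1), x ^ k • p k) := by
        simp only [smul_sub, Finset.sum_sub_distrib]
        abel
      rw [e]
      refine (norm_sub_le _ _).trans ?_
      have := norm_add_le (b x - ∑ k ∈ Finset.range (r + 1), x ^ k • q k) (a x - b x)
      linarith [ha x hx1, hb x hx1, hab x hx2]
  have e : ∑ k ∈ Finset.range (r + 1), h ^ k • q k = ∑ k ∈ Finset.range (r + 1), h ^ k • p k :=
    Finset.sum_congr rfl fun k hk => by rw [sub_eq_zero.1 (hpq k hk)]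
  have h1 := ha h hh
  have h2 := hb h hh
  rw [e] at h2
  have := norm_sub_le (a h - ∑ k ∈ Finset.range (r + 1), h ^ k • p k)
    (b h - ∑ k ∈ Finset.range (r + 1), h ^ k • p k)
  rw [sub_sub_sub_cancel_right] at this
  linarith

/-- Iterated partial derivatives in a real variable of a smooth function are smooth. -/
theorem ContDiffOn.iteratedDeriv_left {Ω : Set (ℝ × V)} (hΩ : IsOpen Ω) {G : ℝ × V → E}
    (hG : ContDiffOn ℝ ∞ G Ω) (k : ℕ) :
    ContDiffOn ℝ ∞ (fun x : ℝ × V => iteratedDeriv k (fun h => G (h, x.2)) x.1) Ω := by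
  induction k with
  | zero => simpa using hG
  | succ k ih =>
    have hf : ContDiffOn ℝ ∞ (fun x => fderiv ℝ
        (fun x : ℝ × V => iteratedDeriv k (fun h => G (h, x.2)) x.1) x (1, 0)) Ω :=
      (ih.fderiv_of_isOpen hΩ (by simp)).clm_apply contDiffOn_const
    refine hf.congr fun x hx => ?_
    rw [iteratedDeriv_succ]
    have hd := ((ih.contDiffAt (hΩ.mem_nhds hx)).differentiableAt (by simp)).hasFDerivAt
    have hl : HasDerivAt (fun h : ℝ => (h, x.2)) ((1 : ℝ), (0 : V)) x.1 :=
      (hasDerivAt_id x.1).prodMk (hasDerivAt_const x.1 x.2)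
    exact (hd.comp_hasDerivAt (f := fun h : ℝ => (h, x.2)) x.1 hl).deriv

/-- Taylor expansion in a real variable, with remainder uniform in a compact set of parameters. -/
theorem exists_taylor_bound_of_isCompact {Ω : Set (ℝ × V)} (hΩ : IsOpen Ω) {G : ℝ × V → E}
    (hG : ContDiffOn ℝ ∞ G Ω) {K : Set V} (hK : IsCompact K) {δ : ℝ} (hδ : 0 < δ)
    (hsub : Icc 0 δ ×ˢ K ⊆ Ω) (r : ℕ) :
    ∃ C, ∀ v ∈ K, ∃ p : ℕ → E, ∀ h ∈ Icc 0 δ,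
      ‖G (h, v) - ∑ k ∈ Finset.range (r + 1), h ^ k • p k‖ ≤ C * h ^ (r + 1) := by
  obtain ⟨C, hC⟩ := (isCompact_Icc.prod hK).exists_bound_of_continuousOn
    ((hG.iteratedDeriv_left hΩ (r + 1)).continuousOn.mono hsub)
  refine ⟨C / (r.factorial : ℝ), fun v hv => ?_⟩
  have hslice : ∀ x ∈ Icc 0 δ, ContDiffAt ℝ ∞ (fun h => G (h, v)) x := fun x hx =>
    (hG.contDiffAt (hΩ.mem_nhds (hsub ⟨hx, hv⟩))).comp x (contDiffAt_id.prodMk contDiffAt_const)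
  refine ⟨fun k => ((k.factorial : ℝ)⁻¹) • iteratedDerivWithin k (fun h => G (h, v)) (Icc 0 δ) 0,
    fun h hh => ?_⟩
  have := taylor_mean_remainder_bound (n := r) (f := fun h => G (h, v)) (C := C) hδ.le
    (fun x hx => ((hslice x hx).of_le (by exact_mod_cast le_top)).contDiffWithinAt) hh fun x hx => by
      rw [iteratedDerivWithin_eq_iteratedDeriv (uniqueDiffOn_Icc hδ)
        ((hslice x hx).of_le (by exact_mod_cast le_top)) hx]
      exact hC (x, v) ⟨hx, hv⟩
  rw [taylor_within_apply] at this
  simp only [sub_zero] at this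
  rw [div_mul_eq_mul_div]
  refine le_trans (le_of_eq ?_) this
  congr 2
  exact Finset.sum_congr rfl fun k _ => by rw [smul_smul, mul_comm]

/-- Taylor expansion of a smooth curve, with remainder uniform in the base point. -/
theorem exists_taylor_bound_along {y : ℝ → E} {T : ℝ} (hT : 0 < T)
    (hy : ContDiffOn ℝ ∞ y (Icc 0 T)) (r : ℕ) :
    ∃ C, ∀ t ∈ Ico 0 T, ∃ p : ℕ → E, ∀ h ∈ Icc 0 (T - t),
      ‖y (t + h) - ∑ k ∈ Finset.range (r + 1), h ^ k • p k‖ ≤ C * h ^ (r + 1) := by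
  have hyr : ContDiffOn ℝ (r + 1 : ℕ) y (Icc 0 T) := hy.of_le (by exact_mod_cast le_top)
  obtain ⟨C, hC⟩ := isCompact_Icc.exists_bound_of_continuousOn
    (hyr.continuousOn_iteratedDerivWithin le_rfl (uniqueDiffOn_Icc hT))
  refine ⟨C / (r.factorial : ℝ), fun t ht => ?_⟩
  have hsub : Icc t T ⊆ Icc 0 T := Icc_subset_Icc_left ht.1
  refine ⟨fun k => ((k.factorial : ℝ)⁻¹) • iteratedDerivWithin k y (Icc t T) t, fun h hh => ?_⟩
  have := taylor_mean_remainder_bound (n := r) (f := y) (C := C) (a := t) (b := T) (x := t + h)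
    ht.2.le (by exact_mod_cast hyr.mono hsub) ⟨by linarith [hh.1], by linarith [hh.2]⟩ fun x hx => by
      rw [iteratedDerivWithin, iteratedFDerivWithin_subset hsub (uniqueDiffOn_Icc ht.2)
        (uniqueDiffOn_Icc hT) hyr hx]
      exact hC x (hsub hx)
  rw [taylor_within_apply] at this
  simp only [add_sub_cancel_left] at this
  rw [div_mul_eq_mul_div]
  refine le_trans (le_of_eq ?_) this
  congr 2
  exact Finset.sum_congr rfl fun k _ => by rw [smul_smul, mul_comm]

end Taylor

namespace RungeKutta

open Set

variable {s : ℕ} {E : Type*} [NormedAddCommGroup E] [NormedSpace ℝ E] [FiniteDimensional ℝ E]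

/-- The order of a method carries over to differential equations in any finite-dimensional
normed space. -/
theorem HasOrder.finiteDimensional {M : RungeKutta s} {r : ℕ} (hM : M.HasOrder r) {g : E → E}
    (hg : ContDiff ℝ ∞ g) {T : ℝ} (hT : 0 < T) {y : ℝ → E}
    (hy : ∀ t ∈ Icc 0 T, HasDerivWithinAt y (g (y t)) (Icc 0 T) t) :
    ∃ c : ℝ, ∃ ρ > 0, ∃ h₀ > 0, ∀ h : ℝ, 0 < h → h ≤ h₀ → h ≤ T →
      ∀ Y, Y = M.stageMap g h (y 0) Y → (∀ i, ‖Y i - y 0‖ ≤ ρ) →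
        ‖M.endpoint g h (y 0) Y - y h‖ ≤ c * h ^ (r + 1) := by
  set e := toEuclidean (E := E)
  obtain ⟨c, ρ, hρ, h₀, hh₀, H⟩ := hM _ (fun x => e (g (e.symm x)))
    (e.contDiff.comp (hg.comp e.symm.contDiff)) T (fun t => e (y t)) hT fun t ht => by
      simp only [e.symm_apply_apply]
      exact e.hasFDerivAt.comp_hasDerivWithinAt t (hy t ht)
  set A : ℝ := ‖e.toContinuousLinearMap‖ with hA
  set B : ℝ := ‖e.symm.toContinuousLinearMap‖ with hB
  have hAle : ∀ x, ‖e x‖ ≤ A * ‖x‖ := fun x => e.toContinuousLinearMap.le_opNorm x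
  have hBle : ∀ x, ‖x‖ ≤ B * ‖e x‖ := fun x => by
    simpa using e.symm.toContinuousLinearMap.le_opNorm (e x)
  refine ⟨B * c, ρ / (A + 1), by positivity, h₀, hh₀, fun h hh hhh₀ hhT Y hY hYρ => ?_⟩
  have key := H h hh hhh₀ hhT (fun i => e (Y i)) (e (M.endpoint g h (y 0) Y)) ⟨fun i => by
      conv_lhs => rw [hY]
      simp [stageMap], by simp [endpoint]⟩ fun i => by
      rw [← map_sub]
      refine (hAle _).trans ?_
      have h1 := hYρ i
      rw [le_div_iff₀ (by positivity)] at h1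
      nlinarith [norm_nonneg (Y i - y 0)]
  rw [← map_sub] at key
  refine (hBle _).trans ?_
  rw [mul_assoc]
  gcongr

/-- The local error of a method of order `r` is `O(h ^ (r + 1))`, uniformly along a solution. -/
theorem HasOrder.exists_local_error {M : RungeKutta s} {r : ℕ} (hM : M.HasOrder r) {g : E → E}
    (hg : ContDiff ℝ ∞ g) {L : NNReal} {C : ℝ} (hC : ∀ x, ‖g x‖ ≤ C)
    {Y : ℝ × E → Fin s → E}
    (hY : ∀ x : ℝ × E, |x.1| * (M.coeffBound * L) ≤ 1 / 2 → Y x = M.stageMap g x.1 x.2 (Y x))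
    (hYs : ∀ x : ℝ × E, |x.1| * (M.coeffBound * L) < 1 / 2 → ContDiffAt ℝ ∞ Y x)
    {T : ℝ} (hT : 0 < T) {y : ℝ → E}
    (hy : ∀ t ∈ Icc 0 T, HasDerivWithinAt y (g (y t)) (Icc 0 T) t)
    {δ : ℝ} (hδ : δ * (M.coeffBound * L) < 1 / 2) :
    ∃ c, 0 ≤ c ∧ ∀ t h, 0 ≤ t → 0 < h → h ≤ δ → t + h ≤ T →
      ‖M.endpoint g h (y t) (Y (h, y t)) - y (t + h)‖ ≤ c * h ^ (r + 1) := by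
  rcases le_or_gt δ 0 with hδ0 | hδ0
  · exact ⟨0, le_rfl, fun t h _ h1 h2 => absurd (h1.trans_le h2) hδ0.not_gt⟩
  have hC0 : 0 ≤ C := (norm_nonneg _).trans (hC 0)
  have hycont : ContinuousOn y (Icc 0 T) := fun t ht => (hy t ht).continuousWithinAt
  have hysmooth : ContDiffOn ℝ ∞ y (Icc 0 T) := by
    refine ODE.contDiffOn_enat_Icc_of_hasDerivWithinAt (n := ⊤) (f := fun _ => g) (u := univ) ?_
      hy (mapsTo_univ _ _)
    exact (hg.comp contDiff_snd).contDiffOn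
  set Ω : Set (ℝ × E) := {x | |x.1| * (M.coeffBound * L) < 1 / 2} with hΩdef
  have hΩ : IsOpen Ω := isOpen_lt (by fun_prop) continuous_const
  have hΦ : ContDiffOn ℝ ∞ (fun x : ℝ × E => M.endpoint g x.1 x.2 (Y x)) Ω := by
    intro x hx
    have h1 : ContDiffAt ℝ ∞ Y x := hYs x hx
    have h2 : ∀ j, ContDiffAt ℝ ∞ (fun x => g (Y x j)) x := fun j =>
      hg.contDiffAt.comp x (contDiffAt_pi.1 h1 j)
    apply ContDiffAt.contDiffWithinAt
    exact contDiffAt_snd.add (contDiffAt_fst.smul (ContDiffAt.sum fun j _ => (h2 j).const_smul _))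
  obtain ⟨A, hA⟩ := exists_taylor_bound_of_isCompact hΩ hΦ (isCompact_Icc.image_of_continuousOn hycont)
    hδ0 (by
      rintro ⟨h, v⟩ ⟨hh, -⟩
      show |h| * _ < _
      rw [abs_of_nonneg hh.1]
      exact lt_of_le_of_lt (by gcongr; exact hh.2) hδ) r
  obtain ⟨B, hB⟩ := exists_taylor_bound_along hT hysmooth r
  refine ⟨|A + B|, abs_nonneg _, fun t h ht hh hhδ hhT => ?_⟩
  have htT : t < T := by linarith
  obtain ⟨p, hp⟩ := hA (y t) (mem_image_of_mem y ⟨ht, htT.le⟩)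
  obtain ⟨q, hq⟩ := hB t ⟨ht, htT⟩
  have hshift : ∀ x ∈ Icc 0 (T - t),
      HasDerivWithinAt (fun x => y (t + x)) (g (y (t + x))) (Icc 0 (T - t)) x := fun x hx => by
    have h1 := hy (t + x) ⟨by linarith [hx.1], by linarith [hx.2]⟩
    have h2 : HasDerivWithinAt (fun x => t + x) 1 (Icc 0 (T - t)) x :=
      ((hasDerivAt_id x).const_add t).hasDerivWithinAt
    simpa [Function.comp_def] using h1.scomp x h2 fun u hu => ⟨by linarith [hu.1], by linarith [hu.2]⟩
  obtain ⟨c, ρ, hρ, h₀, hh₀, hord⟩ := hM.finiteDimensional hg (sub_pos.2 htT) hshift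
  simp only [add_zero] at hord
  have hCpos : 0 < M.coeffBound * C + 1 := by positivity
  have hδ' : 0 < min (min δ (T - t)) (min h₀ (ρ / (M.coeffBound * C + 1))) :=
    lt_min (lt_min hδ0 (sub_pos.2 htT)) (lt_min hh₀ (by positivity))
  have := norm_sub_le_of_taylor (r := r) (δ := min δ (T - t)) hδ'
    (a := fun h => M.endpoint g h (y t) (Y (h, y t))) (b := fun h => y (t + h))
    (fun x hx => hp x ⟨hx.1.le, hx.2.trans (min_le_left _ _)⟩)
    (fun x hx => hq x ⟨hx.1.le, hx.2.trans (min_le_right _ _)⟩)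
    (C := c) (fun x hx => by
      have hx1 := hx.2.trans (min_le_left _ _)
      have hx2 := hx.2.trans (min_le_right _ _)
      have hxδ := hx1.trans (min_le_left _ _)
      have hst : Y (x, y t) = M.stageMap g x (y t) (Y (x, y t)) := hY (x, y t) (by
        simp only
        rw [abs_of_pos hx.1]
        exact le_trans (by gcongr) hδ.le)
      refine hord x hx.1 (hx2.trans (min_le_left _ _)) (hx1.trans (min_le_right _ _)) _ hst
        fun i => ?_
      rw [hst]
      refine (M.norm_stageMap_sub_const_le hC0 (y t) (fun j => hC _) i).trans ?_
      rw [abs_of_pos hx.1]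
      have h3 := hx2.trans (min_le_right _ _)
      rw [le_div_iff₀ hCpos] at h3
      nlinarith [hx.1]) h ⟨hh, le_min hhδ (by linarith)⟩
  refine this.trans ?_
  gcongr
  exact le_abs_self _

/-- Propagation of errors: a stable one-step map with local error `c h ^ (r + 1)` has global
error `O(h ^ r)`. -/
theorem norm_iterate_sub_le {E : Type*} [NormedAddCommGroup E] {Φ : E → E} {y : ℝ → E} {h L c T : ℝ} {r N : ℕ} (hh : 0 ≤ h)
    (hL : 0 ≤ L) (hc : 0 ≤ c) (hNT : N * h ≤ T)
    (hΦ : ∀ x x', ‖Φ x - Φ x'‖ ≤ (1 + L * h) * ‖x - x'‖)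
    (hloc : ∀ t, 0 ≤ t → t + h ≤ T → ‖Φ (y t) - y (t + h)‖ ≤ c * h ^ (r + 1)) :
    ∀ j ≤ N, ‖Φ^[j] (y 0) - y (j * h)‖ ≤ c * T * Real.exp (L * T) * h ^ r := by
  have hT : 0 ≤ T := le_trans (by positivity) hNT
  have key : ∀ j ≤ N, ‖Φ^[j] (y 0) - y (j * h)‖ ≤
      j * (c * h ^ (r + 1)) * Real.exp (L * h * j) := by
    intro j
    induction j with
    | zero => simp
    | succ j ih =>
      intro hj
      have hjh : ((j + 1 : ℕ) : ℝ) * h ≤ T :=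
        le_trans (by gcongr) hNT
      rw [Function.iterate_succ_apply']
      have e : ((j + 1 : ℕ) : ℝ) * h = j * h + h := by push_cast; ring
      have h1 := hloc (j * h) (by positivity) (e ▸ hjh)
      have h2 := (hΦ (Φ^[j] (y 0)) (y (j * h))).trans
        (mul_le_mul_of_nonneg_left (ih (by omega)) (by positivity))
      have h3 : 1 + L * h ≤ Real.exp (L * h) := by linarith [Real.add_one_le_exp (L * h)]
      rw [e]
      refine (norm_sub_le_norm_sub_add_norm_sub _ (Φ (y (j * h))) _).trans
        ((add_le_add h2 h1).trans ?_)
      have h4 : Real.exp (L * h * ((j + 1 : ℕ) : ℝ)) = Real.exp (L * h) * Real.exp (L * h * j) := by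
        rw [← Real.exp_add]
        push_cast
        ring_nf
      rw [h4]
      have h5 : 1 ≤ Real.exp (L * h) * Real.exp (L * h * j) := by
        rw [← Real.exp_add]
        exact Real.one_le_exp (by positivity)
      calc (1 + L * h) * (j * (c * h ^ (r + 1)) * Real.exp (L * h * j)) + c * h ^ (r + 1)
          ≤ Real.exp (L * h) * (j * (c * h ^ (r + 1)) * Real.exp (L * h * j)) +
            c * h ^ (r + 1) * (Real.exp (L * h) * Real.exp (L * h * j)) := by
            refine add_le_add (by gcongr) (le_mul_of_one_le_right (by positivity) h5)
        _ = _ := by push_cast; ring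
  intro j hj
  have hjT : (j : ℝ) * h ≤ T := le_trans (by gcongr) hNT
  refine (key j hj).trans ?_
  calc j * (c * h ^ (r + 1)) * Real.exp (L * h * j)
      = c * (j * h) * Real.exp (L * (j * h)) * h ^ r := by
        rw [show L * h * j = L * (j * h) by ring]
        ring
    _ ≤ _ := by gcongr

end RungeKutta

open Set Filter Topology in
/-- A smooth map coincides on any given ball with a smooth map that is bounded and Lipschitz. -/
theorem ContDiff.exists_bounded_lipschitz_eqOn_ball {E F : Type*} [NormedAddCommGroup E]
    [NormedSpace ℝ E] [FiniteDimensional ℝ E] [NormedAddCommGroup F] [NormedSpace ℝ F] {f : E → F}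
    (hf : ContDiff ℝ ∞ f) (R : ℝ) :
    ∃ (g : E → F) (L : NNReal) (C : ℝ), ContDiff ℝ ∞ g ∧ LipschitzWith L g ∧ (∀ x, ‖g x‖ ≤ C) ∧
      EqOn g f (Metric.ball 0 R) := by
  let χ : ContDiffBump (0 : E) := ⟨max R 1, max R 1 + 1, by positivity, by linarith⟩
  have hg : ContDiff ℝ ∞ fun x => χ x • f x := χ.contDiff.smul hf
  have hsupp : HasCompactSupport fun x => χ x • f x := χ.hasCompactSupport.smul_right
  obtain ⟨C, hC⟩ := hsupp.exists_bound_of_continuous hg.continuous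
  obtain ⟨L, hL⟩ := hg.lipschitzWith_of_hasCompactSupport hsupp (by simp)
  refine ⟨_, L, C, hg, hL, hC, fun x hx => ?_⟩
  have : χ x = 1 := χ.one_of_mem_closedBall
    (Metric.ball_subset_closedBall (Metric.ball_subset_ball (le_max_left R 1) hx))
  simp [this]

namespace RungeKutta

open Set Filter Topology

variable {s : ℕ} {E : Type*} [NormedAddCommGroup E] [NormedSpace ℝ E]

/-- Sums of increments of a symplectic method that satisfy the linearised stage equations
preserve a bilinear form for which the linearised field is infinitesimally symplectic. -/
theorem IsSymplectic.form_add_sum {M : RungeKutta s} (hM : M.IsSymplectic)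
    (Ω : E →L[ℝ] E →L[ℝ] ℝ) {h : ℝ} {v w : E} {k l : Fin s → E}
    (hkl : ∀ i, Ω (k i) (w + h • ∑ j, M.a i j • l j) + Ω (v + h • ∑ j, M.a i j • k j) (l i) = 0) :
    Ω (v + h • ∑ j, M.b j • k j) (w + h • ∑ j, M.b j • l j) = Ω v w := by
  have h1 : ∑ i, M.b i * (Ω (k i) w + Ω v (l i)) +
      h * ∑ i, ∑ j, (M.b j * M.a j i + M.b i * M.a i j) * Ω (k i) (l j) = 0 := by
    have h2 : ∑ i, M.b i * (Ω (k i) (w + h • ∑ j, M.a i j • l j) +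
        Ω (v + h • ∑ j, M.a i j • k j) (l i)) = 0 :=
      Finset.sum_eq_zero fun i _ => by rw [hkl i, mul_zero]
    rw [← h2]
    have h3 : ∑ i, ∑ j, M.b j * M.a j i * Ω (k i) (l j) =
        ∑ i, ∑ j, M.b i * M.a i j * Ω (k j) (l i) := Finset.sum_comm
    simp only [add_mul, Finset.sum_add_distrib, h3, map_add, map_smul, map_sum,
      add_apply, smul_apply, sum_apply,
      smul_eq_mul, mul_add, Finset.mul_sum]
    simp only [mul_left_comm h, mul_assoc]
    abel
  have h4 : ∑ i, ∑ j, M.b i * M.b j * Ω (k i) (l j) =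
      ∑ i, ∑ j, (M.b j * M.a j i + M.b i * M.a i j) * Ω (k i) (l j) :=
    Finset.sum_congr rfl fun i _ => Finset.sum_congr rfl fun j _ => by
      rw [show M.b i * M.b j = M.b j * M.a j i + M.b i * M.a i j by linarith [hM i j]]
  rw [← h4] at h1
  have h5 : Ω (v + h • ∑ j, M.b j • k j) (w + h • ∑ j, M.b j • l j) =
      Ω v w + h * (∑ i, M.b i * (Ω (k i) w + Ω v (l i)) +
        h * ∑ i, ∑ j, M.b i * M.b j * Ω (k i) (l j)) := by
    rw [show ∑ i, ∑ j, M.b i * M.b j * Ω (k i) (l j) = ∑ i, ∑ j, M.b i * M.b j * Ω (k j) (l i) by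
      rw [Finset.sum_comm]
      exact Finset.sum_congr rfl fun i _ => Finset.sum_congr rfl fun j _ => by
        rw [mul_comm (M.b j)]]
    simp only [mul_add, Finset.sum_add_distrib, map_add, map_smul, map_sum,
      add_apply, smul_apply, sum_apply,
      smul_eq_mul, Finset.mul_sum]
    simp only [mul_left_comm h, mul_assoc]
    abel
  rw [h5, h1, mul_zero, add_zero]

/-- The step map of a symplectic method preserves every constant bilinear form for which the
differential equation is Hamiltonian. -/
theorem IsSymplectic.exists_hasFDerivAt_endpoint {M : RungeKutta s} (hM : M.IsSymplectic)
    (Ω : E →L[ℝ] E →L[ℝ] ℝ) {g : E → E} {h : ℝ} {y₀ : E} {Y : E → Fin s → E}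
    (hY : DifferentiableAt ℝ Y y₀) (hst : ∀ᶠ y in 𝓝 y₀, Y y = M.stageMap g h y (Y y))
    (hg : ∀ i, DifferentiableAt ℝ g (Y y₀ i))
    (hΩ : ∀ i a b, Ω (fderiv ℝ g (Y y₀ i) a) b + Ω a (fderiv ℝ g (Y y₀ i) b) = 0) :
    ∃ Φ' : E →L[ℝ] E, HasFDerivAt (fun y => M.endpoint g h y (Y y)) Φ' y₀ ∧
      ∀ v w, Ω (Φ' v) (Φ' w) = Ω v w := by
  set Y' := fderiv ℝ Y y₀
  have hYi : ∀ i, HasFDerivAt (fun y => Y y i) (.proj i ∘L Y') y₀ :=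
    hasFDerivAt_pi'.1 hY.hasFDerivAt
  have hk : ∀ i, HasFDerivAt (fun y => g (Y y i))
      (fderiv ℝ g (Y y₀ i) ∘L (.proj i ∘L Y')) y₀ :=
    fun i => HasFDerivAt.comp y₀ (hg i).hasFDerivAt (hYi i)
  have hsum : ∀ c : Fin s → ℝ, HasFDerivAt (fun y => y + h • ∑ j, c j • g (Y y j))
      (.id ℝ E + h • ∑ j, c j • (fderiv ℝ g (Y y₀ j) ∘L (.proj j ∘L Y'))) y₀ := fun c =>
    (hasFDerivAt_id y₀).add ((HasFDerivAt.fun_sum fun j _ => (hk j).const_smul (c j)).const_smul h)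
  have hlin : ∀ i v, Y' v i = v + h • ∑ j, M.a i j • fderiv ℝ g (Y y₀ j) (Y' v j) := by
    intro i v
    have h1 : (fun y => Y y i) =ᶠ[𝓝 y₀] fun y => y + h • ∑ j, M.a i j • g (Y y j) := by
      filter_upwards [hst] with y hy
      exact congrFun hy i
    have h2 := (hYi i).unique ((hsum (M.a i)).congr_of_eventuallyEq h1)
    simpa [sum_apply] using DFunLike.congr_fun h2 v
  refine ⟨_, hsum M.b, fun v w => ?_⟩
  have := hM.form_add_sum Ω (h := h) (v := v) (w := w)
    (k := fun j => fderiv ℝ g (Y y₀ j) (Y' v j)) (l := fun j => fderiv ℝ g (Y y₀ j) (Y' w j))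
    fun i => by rw [← hlin, ← hlin]; exact hΩ i _ _
  simpa [sum_apply] using this

theorem stageMap_congr (M : RungeKutta s) {f g : E → E} {h : ℝ} {y : E} {Y : Fin s → E}
    (hfg : ∀ j, g (Y j) = f (Y j)) : M.stageMap g h y Y = M.stageMap f h y Y := by
  funext i
  simp [stageMap, hfg]

theorem endpoint_congr (M : RungeKutta s) {f g : E → E} {h : ℝ} {y : E} {Y : Fin s → E}
    (hfg : ∀ j, g (Y j) = f (Y j)) : M.endpoint g h y Y = M.endpoint f h y Y := by
  simp [endpoint, hfg]

variable [FiniteDimensional ℝ E]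

/-- For small step sizes, stages in a given bounded set are unique. -/
theorem exists_stages_unique (M : RungeKutta s) {f : E → E} (hf : ContDiff ℝ ∞ f) (R : ℝ) :
    ∃ h₀ > 0, ∀ h : ℝ, |h| ≤ h₀ → ∀ y (Y Y' : Fin s → E), (∀ i, ‖Y i‖ ≤ R) → (∀ i, ‖Y' i‖ ≤ R) →
      Y = M.stageMap f h y Y → Y' = M.stageMap f h y Y' → Y' = Y := by
  obtain ⟨L, hL⟩ := hf.contDiffOn.exists_lipschitzOnWith (n := ∞) (by simp)
    (convex_closedBall (0 : E) R) (isCompact_closedBall 0 R)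
  refine ⟨1 / (2 * (M.coeffBound * L + 1)), by positivity, fun h hh y Y Y' hY hY' e e' => ?_⟩
  refine M.stages_unique hL (h := h) ?_ (by simpa using hY') (by simpa using hY) e' e
  rw [le_div_iff₀ (by positivity)] at hh
  nlinarith [abs_nonneg h]

/-- One step of a symplectic method, for initial values in a ball and small step size. -/
theorem IsSymplectic.exists_step {M : RungeKutta s} (hM : M.IsSymplectic) {f : E → E}
    (hf : ContDiff ℝ ∞ f) (Ω : E →L[ℝ] E →L[ℝ] ℝ)
    (hΩ : ∀ x a b, Ω (fderiv ℝ f x a) b + Ω a (fderiv ℝ f x b) = 0) (R : ℝ) {ρ ρ' : ℝ}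
    (hρ : 0 < ρ) :
    ∃ h₀ > 0, ∃ (Y : ℝ → E → Fin s → E) (Φ : ℝ → E → E), ∀ h : ℝ, |h| ≤ h₀ → ∀ y, ‖y‖ < R →
      Y h y = M.stageMap f h y (Y h y) ∧ (∀ i, ‖Y h y i - y‖ ≤ ρ) ∧
      Φ h y = M.endpoint f h y (Y h y) ∧
      (∀ Y', Y' = M.stageMap f h y Y' → (∀ i, ‖Y' i - y‖ ≤ ρ') → Y' = Y h y) ∧
      ∃ Φ' : E →L[ℝ] E, HasFDerivAt (Φ h) Φ' y ∧ ∀ v w, Ω (Φ' v) (Φ' w) = Ω v w := by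
  obtain ⟨g, L, C, hgs, hgL, hgC, hgf⟩ := hf.exists_bounded_lipschitz_eqOn_ball (R + ρ)
  have hC0 : 0 ≤ C := (norm_nonneg _).trans (hgC 0)
  obtain ⟨Y, hY, hYs⟩ := M.exists_stages hgL hgs
  obtain ⟨h₁, hh₁, huniq⟩ := M.exists_stages_unique hf (R + max ρ ρ')
  refine ⟨min h₁ (min (1 / (4 * (M.coeffBound * L + 1))) (ρ / (M.coeffBound * C + 1))),
    lt_min hh₁ (lt_min (by positivity) (by positivity)), fun h y => Y (h, y),
    fun h y => M.endpoint g h y (Y (h, y)), fun h hh y hy => ?_⟩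
  have hhL : |h| * (M.coeffBound * L) < 1 / 2 := by
    have := hh.trans ((min_le_right _ _).trans (min_le_left _ _))
    rw [le_div_iff₀ (by positivity)] at this
    nlinarith [abs_nonneg h, mul_nonneg (abs_nonneg h) (M.coeffBound * L).coe_nonneg]
  have hhC : |h| * (M.coeffBound * C) ≤ ρ := by
    have := hh.trans ((min_le_right _ _).trans (min_le_right _ _))
    rw [le_div_iff₀ (by positivity)] at this
    nlinarith [abs_nonneg h]
  have hst : ∀ y', Y (h, y') = M.stageMap g h y' (Y (h, y')) := fun y' => hY (h, y') hhL.le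
  have hnear : ∀ i, ‖Y (h, y) i - y‖ ≤ ρ := fun i => by
    rw [hst]
    exact (M.norm_stageMap_sub_const_le hC0 y (fun j => hgC _) i).trans hhC
  have hball : ∀ i, Y (h, y) i ∈ Metric.ball (0 : E) (R + ρ) := fun i => by
    rw [mem_ball_zero_iff]
    linarith [hnear i, norm_le_norm_add_norm_sub' (Y (h, y) i) y]
  have hfst : Y (h, y) = M.stageMap f h y (Y (h, y)) :=
    (hst y).trans (M.stageMap_congr fun j => hgf (hball j))
  refine ⟨hfst, hnear, M.endpoint_congr fun j => hgf (hball j), fun Y' hY' hn => ?_, ?_⟩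
  · refine huniq h (hh.trans (min_le_left _ _)) y _ _ (fun i => ?_) (fun i => ?_) hfst hY'
    · linarith [hnear i, norm_le_norm_add_norm_sub' (Y (h, y) i) y, le_max_left ρ ρ']
    · linarith [hn i, norm_le_norm_add_norm_sub' (Y' i) y, le_max_right ρ ρ']
  · have hfd : ∀ i, fderiv ℝ g (Y (h, y) i) = fderiv ℝ f (Y (h, y) i) := fun i =>
      (hgf.eventuallyEq_of_mem (Metric.isOpen_ball.mem_nhds (hball i))).fderiv_eq
    refine hM.exists_hasFDerivAt_endpoint Ω (Y := fun y => Y (h, y)) ?_ (.of_forall hst)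
      (fun i => hgs.differentiable (by simp) _) fun i a b => by rw [hfd]; exact hΩ _ a b
    exact ((hYs (h, y) hhL).differentiableAt (by simp)).comp y
      ((differentiableAt_const h).prodMk differentiableAt_id)

/-- Convergence of order `r` of a Runge-Kutta method for a smooth differential equation. -/
theorem HasOrder.exists_global_error {M : RungeKutta s} {r : ℕ} (hM : M.HasOrder r) (hr : 1 ≤ r)
    {f : E → E} (hf : ContDiff ℝ ∞ f) {T : ℝ} (hT : 0 < T) {y : ℝ → E}
    (hy : ∀ t ∈ Icc 0 T, HasDerivWithinAt y (f (y t)) (Icc 0 T) t) :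
    ∃ c, 0 ≤ c ∧ ∀ ρ > 0, ∀ ρ' > 0, ∃ h₀ > 0, ∀ h, 0 < h → h ≤ h₀ → ∀ N : ℕ, N * h ≤ T →
      ∃ (η : ℕ → E) (Y : ℕ → Fin s → E), η 0 = y 0 ∧
        (∀ j < N, Y j = M.stageMap f h (η j) (Y j) ∧ (∀ i, ‖Y j i - η j‖ ≤ ρ) ∧
          η (j + 1) = M.endpoint f h (η j) (Y j) ∧
          ∀ Y', Y' = M.stageMap f h (η j) Y' → (∀ i, ‖Y' i - η j‖ ≤ ρ') → Y' = Y j) ∧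
        ∀ j ≤ N, ‖η j - y (j * h)‖ ≤ c * h ^ r ∧ ‖η j - y (j * h)‖ ≤ 1 := by
  have hycont : ContinuousOn y (Icc 0 T) := fun t ht => (hy t ht).continuousWithinAt
  obtain ⟨R, hR⟩ := isCompact_Icc.exists_bound_of_continuousOn hycont
  obtain ⟨g, L, C, hgs, hgL, hgC, hgf⟩ := hf.exists_bounded_lipschitz_eqOn_ball (R + 3)
  have hC0 : 0 ≤ C := (norm_nonneg _).trans (hgC 0)
  obtain ⟨Y, hY, hYs⟩ := M.exists_stages hgL hgs
  have hyg : ∀ t ∈ Icc 0 T, HasDerivWithinAt y (g (y t)) (Icc 0 T) t := fun t ht => by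
    rw [hgf (mem_ball_zero_iff.2 (by linarith [hR t ht]))]
    exact hy t ht
  set α : ℝ := M.coeffBound * L with hα
  have hα0 : 0 ≤ α := by positivity
  have hδ : 1 / (4 * (α + 1)) * α < 1 / 2 := by
    rw [div_mul_eq_mul_div, div_lt_iff₀ (by positivity)]
    linarith
  obtain ⟨c, hc0, hloc⟩ := hM.exists_local_error hgs hgC hY hYs hT hyg hδ
  set c' := c * T * Real.exp (2 * α * T) with hc'
  have hc'0 : 0 ≤ c' := by positivity
  refine ⟨c', hc'0, fun ρ hρ ρ' hρ' => ?_⟩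
  obtain ⟨h₁, hh₁, huniq⟩ := M.exists_stages_unique hf (R + 1 + max 1 ρ')
  refine ⟨min (min h₁ (1 / (4 * (α + 1))))
    (min (min ρ 1 / (M.coeffBound * C + 1)) (min 1 (1 / (c' + 1)))),
    lt_min (lt_min hh₁ (by positivity)) (lt_min (by positivity) (by positivity)),
    fun h hh hhle N hN => ?_⟩
  have hle1 : h ≤ h₁ := hhle.trans ((min_le_left _ _).trans (min_le_left _ _))
  have hleδ : h ≤ 1 / (4 * (α + 1)) := hhle.trans ((min_le_left _ _).trans (min_le_right _ _))
  have hleρ : h * (M.coeffBound * C) ≤ min ρ 1 := by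
    have := hhle.trans ((min_le_right _ _).trans (min_le_left _ _))
    rw [le_div_iff₀ (by positivity)] at this
    nlinarith
  have hle2 : h ≤ 1 := hhle.trans ((min_le_right _ _).trans ((min_le_right _ _).trans
    (min_le_left _ _)))
  have hlec : c' * h ^ r ≤ 1 := by
    have h1 := hhle.trans ((min_le_right _ _).trans ((min_le_right _ _).trans (min_le_right _ _)))
    rw [le_div_iff₀ (by positivity)] at h1
    have h2 : h ^ r ≤ h := by simpa using pow_le_pow_of_le_one hh.le hle2 hr
    nlinarith
  have hhα : |h| * α ≤ 1 / 2 := by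
    rw [abs_of_pos hh]
    exact le_trans (by gcongr) hδ.le
  have hst : ∀ x, Y (h, x) = M.stageMap g h x (Y (h, x)) := fun x => hY (h, x) hhα
  have hΦ : ∀ x x', ‖M.endpoint g h x (Y (h, x)) - M.endpoint g h x' (Y (h, x'))‖ ≤
      (1 + 2 * α * h) * ‖x - x'‖ := fun x x' => by
    have h1 := M.norm_endpoint_sub_le (hgL.lipschitzOnWith (s := univ)) (h := h) (y := x) (y' := x')
      (Y := Y (h, x)) (Y' := Y (h, x')) (by simp) (by simp)
    have h2 := M.norm_stages_sub_le (hgL.lipschitzOnWith (s := univ)) hhα (y := x) (y' := x')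
      (by simp) (by simp) (hst x) (hst x')
    refine h1.trans ?_
    rw [abs_of_pos hh, ← mul_assoc (M.coeffBound : ℝ), ← hα]
    calc ‖x - x'‖ + h * (α * ‖Y (h, x) - Y (h, x')‖)
        ≤ ‖x - x'‖ + h * (α * (2 * ‖x - x'‖)) := by gcongr
      _ = _ := by ring
  set η : ℕ → E := fun j => (fun x => M.endpoint g h x (Y (h, x)))^[j] (y 0) with hη
  have herr : ∀ j ≤ N, ‖η j - y (j * h)‖ ≤ c' * h ^ r :=
    norm_iterate_sub_le hh.le (by positivity) hc0 hN hΦ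
      fun t ht htT => hloc t h ht hh hleδ htT
  have hηR : ∀ j ≤ N, ‖η j‖ ≤ R + 1 := fun j hj => by
    have h1 : ((j : ℝ) * h) ∈ Icc 0 T := ⟨by positivity, le_trans (by gcongr) hN⟩
    linarith [hR _ h1, herr j hj, norm_le_norm_add_norm_sub' (η j) (y (j * h))]
  refine ⟨η, fun j => Y (h, η j), rfl, fun j hj => ?_,
    fun j hj => ⟨herr j hj, (herr j hj).trans hlec⟩⟩
  have hnear : ∀ i, ‖Y (h, η j) i - η j‖ ≤ min ρ 1 := fun i => by
    rw [hst]
    refine (M.norm_stageMap_sub_const_le hC0 (η j) (fun _ => hgC _) i).trans ?_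
    rwa [abs_of_pos hh]
  have hball : ∀ i, ‖Y (h, η j) i‖ ≤ R + 2 := fun i => by
    linarith [(hnear i).trans (min_le_right _ _), hηR j hj.le,
      norm_le_norm_add_norm_sub' (Y (h, η j) i) (η j)]
  have hfg : ∀ i, g (Y (h, η j) i) = f (Y (h, η j) i) := fun i =>
    hgf (mem_ball_zero_iff.2 (by linarith [hball i]))
  have hfst : Y (h, η j) = M.stageMap f h (η j) (Y (h, η j)) :=
    (hst _).trans (M.stageMap_congr hfg)
  refine ⟨hfst, fun i => (hnear i).trans (min_le_left _ _), ?_, fun Y' hY' hn => ?_⟩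
  · rw [hη]
    simp only [Function.iterate_succ_apply']
    exact M.endpoint_congr hfg
  · refine huniq h (by rwa [abs_of_pos hh]) (η j) _ _ (fun i => ?_) (fun i => ?_) hfst hY'
    · linarith [hball i, le_max_left 1 ρ']
    · linarith [hn i, norm_le_norm_add_norm_sub' (Y' i) (η j), le_max_right 1 ρ', hηR j hj.le]

end RungeKutta

/-- The two-form `dq ∧ dp` on the space of pairs `(q, p)`, as a continuous bilinear map. -/
noncomputable def canonicalForm (n : ℕ) :
    EuclideanSpace ℝ (Fin n) × EuclideanSpace ℝ (Fin n) →L[ℝ]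
      EuclideanSpace ℝ (Fin n) × EuclideanSpace ℝ (Fin n) →L[ℝ] ℝ :=
  (innerSL ℝ).bilinearComp (.fst ℝ _ _) (.snd ℝ _ _) -
    (innerSL ℝ).bilinearComp (.snd ℝ _ _) (.fst ℝ _ _)

theorem canonicalForm_apply {n : ℕ}
    (v w : EuclideanSpace ℝ (Fin n) × EuclideanSpace ℝ (Fin n)) :
    canonicalForm n v w = inner ℝ v.1 w.2 - inner ℝ v.2 w.1 := rfl

theorem canonicalForm_swap {n : ℕ}
    (v w : EuclideanSpace ℝ (Fin n) × EuclideanSpace ℝ (Fin n)) :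
    canonicalForm n v w = -canonicalForm n w v := by
  rw [canonicalForm_apply, canonicalForm_apply, real_inner_comm w.2, real_inner_comm w.1]
  ring

theorem matApply_eq_toEuclideanLin {m : ℕ} (J : Matrix (Fin m) (Fin m) ℝ)
    (v : EuclideanSpace ℝ (Fin m)) : matApply J v = Matrix.toEuclideanLin J v := rfl

namespace DarbouxCoordinates

open Set

variable {m n k s : ℕ} {J : Matrix (Fin m) (Fin m) ℝ} (D : DarbouxCoordinates J n k)
  {H : EuclideanSpace ℝ (Fin m) → ℝ}
  {lam : EuclideanSpace ℝ (Fin n) × EuclideanSpace ℝ (Fin n) → EuclideanSpace ℝ (Fin k)}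

/-- The coordinates `(q, p)` of a point of phase space. -/
noncomputable def proj :
    EuclideanSpace ℝ (Fin m) →L[ℝ] EuclideanSpace ℝ (Fin n) × EuclideanSpace ℝ (Fin n) :=
  ((ContinuousLinearMap.fst ℝ _ _).prod (.fst ℝ _ _ ∘L .snd ℝ _ _)) ∘L
    D.S.symm.toContinuousLinearMap

theorem proj_apply (z : EuclideanSpace ℝ (Fin m)) :
    D.proj z = ((D.S.symm z).1, (D.S.symm z).2.1) := rfl

/-- The point of phase space with coordinates `q`, `p` and `λ = lam (q, p)`. -/
noncomputable def lift
    (lam : EuclideanSpace ℝ (Fin n) × EuclideanSpace ℝ (Fin n) → EuclideanSpace ℝ (Fin k))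
    (x : EuclideanSpace ℝ (Fin n) × EuclideanSpace ℝ (Fin n)) : EuclideanSpace ℝ (Fin m) :=
  D.S (x.1, x.2, lam x)

@[simp]
theorem proj_lift (x : EuclideanSpace ℝ (Fin n) × EuclideanSpace ℝ (Fin n)) :
    D.proj (D.lift lam x) = x := by
  simp [proj_apply, lift]

theorem contDiff_lift (hlam : ContDiff ℝ ∞ lam) : ContDiff ℝ ∞ (D.lift lam) :=
  D.S.contDiff.comp (contDiff_fst.prodMk (contDiff_snd.prodMk hlam))

theorem form_eq_canonicalForm (v w : EuclideanSpace ℝ (Fin m)) :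
    D.form v w = canonicalForm n (D.proj v) (D.proj w) := rfl

theorem inner_S_matApply (v : DarbouxSpace n k) (z : EuclideanSpace ℝ (Fin m)) :
    inner ℝ (D.S v) (matApply J z) =
      inner ℝ v.2.1 (D.proj z).1 - inner ℝ v.1 (D.proj z).2 := by
  conv_lhs => rw [← D.S.apply_symm_apply z]
  exact D.form_eq v (D.S.symm z)

theorem ext_inner_S {z z' : EuclideanSpace ℝ (Fin m)}
    (h : ∀ v, inner ℝ (D.S v) z = inner ℝ (D.S v) z') : z = z' :=
  ext_inner_left ℝ fun v => by simpa using h (D.S.symm v)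

theorem matApply_eq_iff {z z' : EuclideanSpace ℝ (Fin m)} :
    matApply J z = matApply J z' ↔ D.proj z = D.proj z' := by
  constructor
  · intro h
    have key : ∀ v : DarbouxSpace n k, inner ℝ v.2.1 (D.proj z).1 - inner ℝ v.1 (D.proj z).2 =
        inner ℝ v.2.1 (D.proj z').1 - inner ℝ v.1 (D.proj z').2 := fun v => by
      rw [← inner_S_matApply, h, inner_S_matApply]
    refine Prod.ext (ext_inner_left ℝ fun v => ?_) (ext_inner_left ℝ fun v => ?_)
    · simpa using key (0, v, 0)
    · simpa using key (v, 0, 0)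
  · intro h
    exact D.ext_inner_S fun v => by rw [inner_S_matApply, inner_S_matApply, h]

theorem matApply_eq_add_sum_iff {z z₀ : EuclideanSpace ℝ (Fin m)} {h : ℝ} {c : Fin s → ℝ}
    {F : Fin s → EuclideanSpace ℝ (Fin m)} :
    matApply J z = matApply J z₀ + h • ∑ j, c j • matApply J (F j) ↔
      D.proj z = D.proj z₀ + h • ∑ j, c j • D.proj (F j) := by
  have h1 : matApply J z₀ + h • ∑ j, c j • matApply J (F j) =
      matApply J (z₀ + h • ∑ j, c j • F j) := by
    simp [matApply_eq_toEuclideanLin]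
  rw [h1, D.matApply_eq_iff]
  simp

/-- The Hamiltonian restricted to the graph of `lam`, as a function of `(q, p)`. -/
noncomputable def reducedHamiltonian (H : EuclideanSpace ℝ (Fin m) → ℝ)
    (lam : EuclideanSpace ℝ (Fin n) × EuclideanSpace ℝ (Fin n) → EuclideanSpace ℝ (Fin k))
    (x : EuclideanSpace ℝ (Fin n) × EuclideanSpace ℝ (Fin n)) : ℝ :=
  H (D.lift lam x)

/-- The Hamiltonian vector field of the reduced Hamiltonian. -/
noncomputable def reducedField (H : EuclideanSpace ℝ (Fin m) → ℝ)
    (lam : EuclideanSpace ℝ (Fin n) × EuclideanSpace ℝ (Fin n) → EuclideanSpace ℝ (Fin k))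
    (x : EuclideanSpace ℝ (Fin n) × EuclideanSpace ℝ (Fin n)) :
    EuclideanSpace ℝ (Fin n) × EuclideanSpace ℝ (Fin n) :=
  ((InnerProductSpace.toDual ℝ _).symm
      (fderiv ℝ (D.reducedHamiltonian H lam) x ∘L .inr ℝ _ _),
    -(InnerProductSpace.toDual ℝ _).symm
      (fderiv ℝ (D.reducedHamiltonian H lam) x ∘L .inl ℝ _ _))

theorem canonicalForm_reducedField
    (x v : EuclideanSpace ℝ (Fin n) × EuclideanSpace ℝ (Fin n)) :
    canonicalForm n (D.reducedField H lam x) v =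
      fderiv ℝ (D.reducedHamiltonian H lam) x v := by
  rw [canonicalForm_apply, reducedField]
  simp only [inner_neg_left, InnerProductSpace.toDual_symm_apply, sub_neg_eq_add,
    ContinuousLinearMap.comp_apply, ContinuousLinearMap.inr_apply, ContinuousLinearMap.inl_apply]
  rw [← map_add]
  simp

theorem contDiff_reducedHamiltonian (hH : ContDiff ℝ ∞ H) (hlam : ContDiff ℝ ∞ lam) :
    ContDiff ℝ ∞ (D.reducedHamiltonian H lam) :=
  hH.comp (D.contDiff_lift hlam)

theorem contDiff_reducedField (hH : ContDiff ℝ ∞ H) (hlam : ContDiff ℝ ∞ lam) :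
    ContDiff ℝ ∞ (D.reducedField H lam) := by
  have h1 : ContDiff ℝ ∞ (fderiv ℝ (D.reducedHamiltonian H lam)) :=
    (D.contDiff_reducedHamiltonian hH hlam).fderiv_right (by simp)
  refine ContDiff.prodMk ?_ (ContDiff.neg ?_)
  · exact (InnerProductSpace.toDual ℝ _).symm.contDiff.comp (h1.clm_comp contDiff_const)
  · exact (InnerProductSpace.toDual ℝ _).symm.contDiff.comp (h1.clm_comp contDiff_const)

/-- The reduced field is infinitesimally symplectic. -/
theorem canonicalForm_fderiv_reducedField (hH : ContDiff ℝ ∞ H) (hlam : ContDiff ℝ ∞ lam)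
    (x a b : EuclideanSpace ℝ (Fin n) × EuclideanSpace ℝ (Fin n)) :
    canonicalForm n (fderiv ℝ (D.reducedField H lam) x a) b +
      canonicalForm n a (fderiv ℝ (D.reducedField H lam) x b) = 0 := by
  have hs := D.contDiff_reducedHamiltonian hH hlam
  have h1 : ContDiff ℝ ∞ (fderiv ℝ (D.reducedHamiltonian H lam)) := hs.fderiv_right (by simp)
  have key : ∀ a b, canonicalForm n (fderiv ℝ (D.reducedField H lam) x a) b =
      fderiv ℝ (fderiv ℝ (D.reducedHamiltonian H lam)) x a b := by
    intro a b
    have e : (fun y => canonicalForm n (D.reducedField H lam y)) =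
        fderiv ℝ (D.reducedHamiltonian H lam) := by
      funext y
      exact ContinuousLinearMap.ext (D.canonicalForm_reducedField y)
    rw [← e]
    have h2 := (canonicalForm n).hasFDerivAt.comp x
      ((D.contDiff_reducedField hH hlam).differentiable (by simp) x).hasFDerivAt
    rw [show (fun y => canonicalForm n (D.reducedField H lam y)) =
      canonicalForm n ∘ D.reducedField H lam from rfl, h2.fderiv]
    rfl
  have hsymm : IsSymmSndFDerivAt ℝ (D.reducedHamiltonian H lam) x :=
    (contDiff_infty.1 hs 2).contDiffAt.isSymmSndFDerivAt (by simp)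
  rw [canonicalForm_swap a, key, key, hsymm.eq]
  ring

theorem inner_gradLam (hH : ContDiff ℝ ∞ H) (q p : EuclideanSpace ℝ (Fin n))
    (l w : EuclideanSpace ℝ (Fin k)) :
    inner ℝ (D.gradLam H q p l) w = fderiv ℝ H (D.S (q, p, l)) (D.S (0, 0, w)) := by
  have h1 : HasFDerivAt (fun l' : EuclideanSpace ℝ (Fin k) => D.S (q, p, l'))
      (D.S.toContinuousLinearMap ∘L (.inr ℝ _ _ ∘L .inr ℝ _ _)) l :=
    D.S.hasFDerivAt.comp l (HasFDerivAt.comp l (hasFDerivAt_prodMk_right q (p, l))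
      (hasFDerivAt_prodMk_right p l))
  have h2 := (hH.differentiable (by simp) (D.S (q, p, l))).hasFDerivAt.comp l h1
  rw [gradLam, gradient, InnerProductSpace.toDual_symm_apply]
  rw [show (fun l' => H (D.S (q, p, l'))) = H ∘ fun l' => D.S (q, p, l') from rfl, h2.fderiv]
  rfl

theorem mem_constraintSet_iff (hidx : ∀ q p l, D.gradLam H q p l = 0 ↔ l = lam (q, p))
    {z : EuclideanSpace ℝ (Fin m)} : z ∈ D.constraintSet H ↔ D.lift lam (D.proj z) = z := by
  rw [constraintSet, mem_ofPred_eq, hidx, lift, ← D.S.symm.injective.eq_iff,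
    D.S.symm_apply_apply, proj_apply]
  constructor
  · intro h
    rw [← h]
  · intro h
    exact (congrArg (fun u => u.2.2) h).symm

theorem lift_mem_constraintSet (hidx : ∀ q p l, D.gradLam H q p l = 0 ↔ l = lam (q, p))
    (x : EuclideanSpace ℝ (Fin n) × EuclideanSpace ℝ (Fin n)) :
    D.lift lam x ∈ D.constraintSet H := by
  rw [D.mem_constraintSet_iff hidx, proj_lift]

theorem mem_constraintSet_iff_fderiv (hH : ContDiff ℝ ∞ H) {z : EuclideanSpace ℝ (Fin m)} :
    z ∈ D.constraintSet H ↔ ∀ w, fderiv ℝ H z (D.S (0, 0, w)) = 0 := by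
  have h1 : ∀ w, inner ℝ (D.gradLam H (D.S.symm z).1 (D.S.symm z).2.1 (D.S.symm z).2.2) w =
      fderiv ℝ H z (D.S (0, 0, w)) := fun w => by
    rw [D.inner_gradLam hH]
    simp
  rw [constraintSet, mem_ofPred_eq]
  constructor
  · intro h w
    rw [← h1, h, inner_zero_left]
  · intro h
    exact ext_inner_right ℝ fun w => by rw [h1, h, inner_zero_left]

/-- On the constraint set the differential of `H` is that of the reduced Hamiltonian. -/
theorem fderiv_S_eq (hH : ContDiff ℝ ∞ H) (hlam : ContDiff ℝ ∞ lam)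
    (hidx : ∀ q p l, D.gradLam H q p l = 0 ↔ l = lam (q, p)) {z : EuclideanSpace ℝ (Fin m)}
    (hz : z ∈ D.constraintSet H) (v : DarbouxSpace n k) :
    fderiv ℝ H z (D.S v) = fderiv ℝ (D.reducedHamiltonian H lam) (D.proj z) (v.1, v.2.1) := by
  set x := D.proj z
  have hzx : D.lift lam x = z := (D.mem_constraintSet_iff hidx).1 hz
  have h1 : HasFDerivAt (D.lift lam)
      (D.S.toContinuousLinearMap ∘L
        ((ContinuousLinearMap.fst ℝ _ _).prod ((ContinuousLinearMap.snd ℝ _ _).prod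
          (fderiv ℝ lam x)))) x :=
    D.S.hasFDerivAt.comp x (hasFDerivAt_fst.prodMk (hasFDerivAt_snd.prodMk
      (hlam.differentiable (by simp) x).hasFDerivAt))
  have h2 := (hH.differentiable (by simp) (D.lift lam x)).hasFDerivAt.comp x h1
  rw [show D.reducedHamiltonian H lam = H ∘ D.lift lam from rfl, h2.fderiv, hzx]
  have h3 : v = (v.1, v.2.1, fderiv ℝ lam x (v.1, v.2.1)) +
      (0, 0, v.2.2 - fderiv ℝ lam x (v.1, v.2.1)) := by simp
  conv_lhs => rw [h3, map_add, map_add, (D.mem_constraintSet_iff_fderiv hH).1 hz, add_zero]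
  rfl

/-- The equation `J v = ∇H(z)` means that `z` satisfies the constraint and that the `(q, p)`-part
of `v` is given by the reduced field. -/
theorem matApply_eq_gradient_iff (hH : ContDiff ℝ ∞ H) (hlam : ContDiff ℝ ∞ lam)
    (hidx : ∀ q p l, D.gradLam H q p l = 0 ↔ l = lam (q, p)) {v z : EuclideanSpace ℝ (Fin m)} :
    matApply J v = gradient H z ↔
      z ∈ D.constraintSet H ∧ D.proj v = D.reducedField H lam (D.proj z) := by
  have hgrad : ∀ u, inner ℝ u (gradient H z) = fderiv ℝ H z u := fun u => by
    rw [real_inner_comm, gradient, InnerProductSpace.toDual_symm_apply]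
  constructor
  · intro h
    have key : ∀ u : DarbouxSpace n k,
        fderiv ℝ H z (D.S u) = inner ℝ u.2.1 (D.proj v).1 - inner ℝ u.1 (D.proj v).2 := fun u => by
      rw [← hgrad, ← h, inner_S_matApply]
    have hz : z ∈ D.constraintSet H :=
      (D.mem_constraintSet_iff_fderiv hH).2 fun w => by simp [key]
    refine ⟨hz, ?_⟩
    have h1 : ∀ a : EuclideanSpace ℝ (Fin n) × EuclideanSpace ℝ (Fin n),
        canonicalForm n (D.proj v) a = canonicalForm n (D.reducedField H lam (D.proj z)) a := by
      intro a
      rw [canonicalForm_reducedField, ← D.fderiv_S_eq hH hlam hidx hz (a.1, a.2, 0), key,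
        canonicalForm_apply, real_inner_comm a.1, real_inner_comm a.2]
    refine Prod.ext (ext_inner_right ℝ fun a => ?_) (ext_inner_right ℝ fun a => ?_)
    · simpa [canonicalForm_apply] using h1 (0, a)
    · simpa [canonicalForm_apply] using h1 (a, 0)
  · rintro ⟨hz, hv⟩
    refine D.ext_inner_S fun u => ?_
    rw [hgrad, inner_S_matApply, hv, D.fderiv_S_eq hH hlam hidx hz, ← canonicalForm_reducedField,
      canonicalForm_apply, real_inner_comm u.1, real_inner_comm u.2.1]

/-- The Runge-Kutta equations for `J ż = ∇H(z)` are those for the reduced differential equation,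
with stages on the constraint set. -/
theorem isStep_iff (hH : ContDiff ℝ ∞ H) (hlam : ContDiff ℝ ∞ lam)
    (hidx : ∀ q p l, D.gradLam H q p l = 0 ↔ l = lam (q, p)) (M : RungeKutta s) {h : ℝ}
    {z₀ z₁ : EuclideanSpace ℝ (Fin m)} {Z : Fin s → EuclideanSpace ℝ (Fin m)} :
    M.IsStep J H h z₀ Z z₁ ↔ (∀ i, Z i ∈ D.constraintSet H) ∧
      (fun i => D.proj (Z i)) =
        M.stageMap (D.reducedField H lam) h (D.proj z₀) (fun i => D.proj (Z i)) ∧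
      D.proj z₁ = M.endpoint (D.reducedField H lam) h (D.proj z₀) (fun i => D.proj (Z i)) := by
  simp only [RungeKutta.IsStep, D.matApply_eq_add_sum_iff, D.matApply_eq_gradient_iff hH hlam hidx,
    funext_iff, RungeKutta.stageMap, RungeKutta.endpoint]
  constructor
  · rintro ⟨F, h1, h2, h3⟩
    refine ⟨fun i => (h3 i).1, fun i => ?_, ?_⟩
    · simpa only [(h3 _).2] using h1 i
    · simpa only [(h3 _).2] using h2
  · rintro ⟨h1, h2, h3⟩
    refine ⟨fun j => D.lift lam (D.reducedField H lam (D.proj (Z j))), fun i => ?_, ?_,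
      fun j => ⟨h1 j, ?_⟩⟩
    · simpa only [proj_lift] using h2 i
    · simpa only [proj_lift] using h3
    · rw [proj_lift]

/-- Constrained steps with stages near the starting point, in reduced coordinates. -/
theorem isConstrainedStep_iff (hH : ContDiff ℝ ∞ H) (hlam : ContDiff ℝ ∞ lam)
    (hidx : ∀ q p l, D.gradLam H q p l = 0 ↔ l = lam (q, p)) (M : RungeKutta s) {ρ h : ℝ}
    {z₀ z₁ : EuclideanSpace ℝ (Fin m)} {Z : Fin s → EuclideanSpace ℝ (Fin m)} :
    M.IsConstrainedStep D H ρ h z₀ Z z₁ ↔ ∃ Y : Fin s → _,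
      Y = M.stageMap (D.reducedField H lam) h (D.proj z₀) Y ∧ (∀ i, ‖D.lift lam (Y i) - z₀‖ ≤ ρ) ∧
      Z = (fun i => D.lift lam (Y i)) ∧
      z₁ = D.lift lam (M.endpoint (D.reducedField H lam) h (D.proj z₀) Y) := by
  rw [RungeKutta.IsConstrainedStep, D.isStep_iff hH hlam hidx]
  constructor
  · rintro ⟨⟨h1, h2, h3⟩, h4, h5⟩
    have hZ : ∀ i, D.lift lam (D.proj (Z i)) = Z i := fun i => (D.mem_constraintSet_iff hidx).1 (h1 i)
    refine ⟨_, h2, fun i => ?_, funext fun i => (hZ i).symm, ?_⟩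
    · rw [hZ]
      exact h4 i
    · rw [← h3, (D.mem_constraintSet_iff hidx).1 h5]
  · rintro ⟨Y, h1, h2, rfl, rfl⟩
    simp only [proj_lift]
    exact ⟨⟨fun i => D.lift_mem_constraintSet hidx _, h1, trivial⟩, h2, D.lift_mem_constraintSet hidx _⟩

theorem hasFDerivAt_lift_comp (hlam : ContDiff ℝ ∞ lam)
    {Φ : EuclideanSpace ℝ (Fin n) × EuclideanSpace ℝ (Fin n) →
      EuclideanSpace ℝ (Fin n) × EuclideanSpace ℝ (Fin n)}
    {Φ' : EuclideanSpace ℝ (Fin n) × EuclideanSpace ℝ (Fin n) →L[ℝ]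
      EuclideanSpace ℝ (Fin n) × EuclideanSpace ℝ (Fin n)} {z : EuclideanSpace ℝ (Fin m)}
    (hΦ : HasFDerivAt Φ Φ' (D.proj z)) :
    ∃ L : EuclideanSpace ℝ (Fin m) →L[ℝ] EuclideanSpace ℝ (Fin m),
      HasFDerivAt (fun z => D.lift lam (Φ (D.proj z))) L z ∧
      ∀ v, D.proj (L v) = Φ' (D.proj v) := by
  have h1 := ((D.contDiff_lift hlam).differentiable (by simp) (Φ (D.proj z))).hasFDerivAt
  have h2 := hΦ.comp z D.proj.hasFDerivAt
  have h3 := HasFDerivAt.comp z (f := Φ ∘ D.proj) h1 h2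
  refine ⟨_, h3, fun v => ?_⟩
  have h4 := D.proj.hasFDerivAt.comp z h3
  have h5 : D.proj ∘ D.lift lam ∘ Φ ∘ D.proj = Φ ∘ D.proj := by
    funext z
    simp
  rw [h5] at h4
  exact DFunLike.congr_fun (h4.unique h2) v

theorem exists_lipschitzOnWith_lift (hlam : ContDiff ℝ ∞ lam) (R : ℝ) :
    ∃ L, LipschitzOnWith L (D.lift lam) (Metric.closedBall 0 R) :=
  (D.contDiff_lift hlam).contDiffOn.exists_lipschitzOnWith (n := ∞) (by simp)
    (convex_closedBall _ R) (isCompact_closedBall _ R)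

end DarbouxCoordinates

/-- Exact solutions of `J ż = ∇H(z)` satisfy the constraint and project to solutions of the reduced
differential equation. -/
theorem IsExactSolution.reduced {m n k : ℕ} {J : Matrix (Fin m) (Fin m) ℝ}
    {D : DarbouxCoordinates J n k} {H : EuclideanSpace ℝ (Fin m) → ℝ} (hH : ContDiff ℝ ∞ H)
    {lam : EuclideanSpace ℝ (Fin n) × EuclideanSpace ℝ (Fin n) → EuclideanSpace ℝ (Fin k)}
    (hlam : ContDiff ℝ ∞ lam) (hidx : ∀ q p l, D.gradLam H q p l = 0 ↔ l = lam (q, p)) {T : ℝ}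
    {z : ℝ → EuclideanSpace ℝ (Fin m)} (hz : IsExactSolution J H T z) :
    ∀ t ∈ Set.Icc 0 T, D.lift lam (D.proj (z t)) = z t ∧
      HasDerivWithinAt (fun t => D.proj (z t)) (D.reducedField H lam (D.proj (z t)))
        (Set.Icc 0 T) t := by
  intro t ht
  obtain ⟨v, hv, hJv⟩ := hz t ht
  obtain ⟨h1, h2⟩ := (D.matApply_eq_gradient_iff hH hlam hidx).1 hJv
  refine ⟨(D.mem_constraintSet_iff hidx).1 h1, ?_⟩
  rw [← h2]
  exact D.proj.hasFDerivAt.comp_hasDerivWithinAt t hv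

theorem mainTheorem1 {m n k s : ℕ} (J : Matrix (Fin m) (Fin m) ℝ) (hJ : J.transpose = -J)
    (D : DarbouxCoordinates J n k)
    (H : EuclideanSpace ℝ (Fin m) → ℝ) (hH : ContDiff ℝ ∞ H) (hidx : D.IndexOne H)
    (M : RungeKutta s) (hM : M.IsSymplectic) :
    -- well defined for small steps, and preserves constraint submanifold and symplectic form
    (∀ K : Set (EuclideanSpace ℝ (Fin m)), IsCompact K → K ⊆ D.constraintSet H →
      ∀ ρ > 0, ∃ h₀ > 0, ∃ U : Set (EuclideanSpace ℝ (Fin m)), IsOpen U ∧ K ⊆ U ∧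
      ∃ Ψ : ℝ → EuclideanSpace ℝ (Fin m) → EuclideanSpace ℝ (Fin m),
        ∀ h : ℝ, |h| ≤ h₀ → ∀ z₀ ∈ D.constraintSet H ∩ U,
          (∃! x : (Fin s → EuclideanSpace ℝ (Fin m)) × EuclideanSpace ℝ (Fin m),
            M.IsConstrainedStep D H ρ h z₀ x.1 x.2) ∧
          (∃ Z, M.IsConstrainedStep D H ρ h z₀ Z (Ψ h z₀) ∧ ∀ i, Z i ∈ D.constraintSet H) ∧
          Ψ h z₀ ∈ D.constraintSet H ∧
          ∃ L : EuclideanSpace ℝ (Fin m) →L[ℝ] EuclideanSpace ℝ (Fin m),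
            HasFDerivWithinAt (Ψ h) L (D.constraintSet H) z₀ ∧
            ∀ v ∈ tangentConeAt ℝ (D.constraintSet H) z₀,
              ∀ w ∈ tangentConeAt ℝ (D.constraintSet H) z₀,
                D.form (L v) (L w) = D.form v w) ∧
    -- convergence with the order of the method
    (∀ r : ℕ, 1 ≤ r → M.HasOrder r →
      ∀ (T : ℝ) (z : ℝ → EuclideanSpace ℝ (Fin m)), 0 < T → IsExactSolution J H T z →
      ∃ c : ℝ, ∀ ρ > 0, ∃ h₀ > 0, ∀ h : ℝ, 0 < h → h ≤ h₀ → ∀ N : ℕ, N * h ≤ T →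
        (∃ ζ : ℕ → EuclideanSpace ℝ (Fin m), ζ 0 = z 0 ∧ M.IsTrajectory D H ρ h N ζ) ∧
        ∀ ζ : ℕ → EuclideanSpace ℝ (Fin m), ζ 0 = z 0 → M.IsTrajectory D H ρ h N ζ →
          ∀ j ≤ N, ‖ζ j - z (j * h)‖ ≤ c * h ^ r) := by
  obtain ⟨lam, hlam, hidx⟩ := hidx
  have hf : ContDiff ℝ ∞ (D.reducedField H lam) := D.contDiff_reducedField hH hlam
  set f := D.reducedField H lam
  have hprojle : ∀ z, ‖D.proj z‖ ≤ ‖D.proj‖ * ‖z‖ := D.proj.le_opNorm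
  have hnear : ∀ {z₀ : EuclideanSpace ℝ (Fin m)} {ρ : ℝ} {Y : Fin s → _},
      (∀ i, ‖D.lift lam (Y i) - z₀‖ ≤ ρ) → ∀ i, ‖Y i - D.proj z₀‖ ≤ ‖D.proj‖ * ρ + 1 :=
    fun {z₀ ρ Y} hY i => by
      have h1 := hprojle (D.lift lam (Y i) - z₀)
      rw [map_sub, D.proj_lift] at h1
      have h2 : ‖D.proj‖ * ‖D.lift lam (Y i) - z₀‖ ≤ ‖D.proj‖ * ρ := by
        gcongr
        exact hY i
      linarith
  constructor
  · intro K hK hKC ρ hρ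
    obtain ⟨R, hR⟩ := hK.exists_bound_of_continuousOn D.proj.continuous.continuousOn
    obtain ⟨Λ, hΛ⟩ := D.exists_lipschitzOnWith_lift hlam (R + 2)
    obtain ⟨h₀, hh₀, Y, Φ, hstep⟩ := hM.exists_step hf (canonicalForm n)
      (D.canonicalForm_fderiv_reducedField hH hlam) (R + 1) (ρ' := ‖D.proj‖ * ρ + 1)
      (show 0 < min 1 (ρ / (Λ + 1)) by positivity)
    refine ⟨h₀, hh₀, {z | ‖D.proj z‖ < R + 1},
      isOpen_lt (D.proj.continuous.norm) continuous_const, fun z hz => (hR z hz).trans_lt (by simp),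
      fun h z => D.lift lam (Φ h (D.proj z)), fun h hh z₀ ⟨hz₀C, hz₀U⟩ => ?_⟩
    obtain ⟨hY, hYnear, hΦ, huniq, Φ', hΦ', hsymp⟩ := hstep h hh (D.proj z₀) hz₀U
    have hz₀U : ‖D.proj z₀‖ < R + 1 := hz₀U
    have hYρ : ∀ i, ‖D.lift lam (Y h (D.proj z₀) i) - z₀‖ ≤ ρ := fun i => by
      conv_lhs => rw [← (D.mem_constraintSet_iff hidx).1 hz₀C]
      rw [D.proj_lift]
      have h1 := (hYnear i).trans (min_le_left _ _)
      have h2 := (hYnear i).trans (min_le_right _ _)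
      refine (hΛ.norm_sub_le ?_ ?_).trans ?_
      · rw [mem_closedBall_zero_iff]
        linarith [norm_le_norm_add_norm_sub' (Y h (D.proj z₀) i) (D.proj z₀)]
      · rw [mem_closedBall_zero_iff]
        linarith
      · rw [le_div_iff₀ (by positivity)] at h2
        nlinarith [norm_nonneg (Y h (D.proj z₀) i - D.proj z₀)]
    have hcons : M.IsConstrainedStep D H ρ h z₀ (fun i => D.lift lam (Y h (D.proj z₀) i))
        (D.lift lam (Φ h (D.proj z₀))) :=
      (D.isConstrainedStep_iff hH hlam hidx M).2 ⟨_, hY, hYρ, rfl, by rw [hΦ]⟩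
    refine ⟨⟨(fun i => D.lift lam (Y h (D.proj z₀) i), D.lift lam (Φ h (D.proj z₀))), hcons, ?_⟩,
      ⟨_, hcons, fun i => D.lift_mem_constraintSet hidx _⟩, D.lift_mem_constraintSet hidx _, ?_⟩
    · rintro ⟨Z, z₁⟩ hZ
      obtain ⟨Y', hY', hY'ρ, hZ', hz₁⟩ := (D.isConstrainedStep_iff hH hlam hidx M).1 hZ
      obtain rfl := huniq Y' hY' (hnear hY'ρ)
      simp only at hZ' hz₁
      rw [hZ', hz₁, hΦ]
    · obtain ⟨L, hL, hLproj⟩ := D.hasFDerivAt_lift_comp hlam hΦ'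
      refine ⟨L, hL.hasFDerivWithinAt, fun v _ w _ => ?_⟩
      rw [D.form_eq_canonicalForm, D.form_eq_canonicalForm, hLproj, hLproj, hsymp]
  · intro r hr hord T z hT hz
    have hred := hz.reduced hH hlam hidx
    have hy : ∀ t ∈ Set.Icc 0 T, HasDerivWithinAt (fun t => D.proj (z t)) (f (D.proj (z t)))
        (Set.Icc 0 T) t := fun t ht => (hred t ht).2
    obtain ⟨R, hR⟩ := isCompact_Icc.exists_bound_of_continuousOn
      (f := fun t => D.proj (z t)) fun t ht => (hy t ht).continuousWithinAt
    obtain ⟨Λ, hΛ⟩ := D.exists_lipschitzOnWith_lift hlam (R + 2)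
    obtain ⟨c, hc0, hconv⟩ := hord.exists_global_error hr hf hT hy
    refine ⟨Λ * c, fun ρ hρ => ?_⟩
    obtain ⟨h₀, hh₀, hmain⟩ := hconv (min 1 (ρ / (Λ + 1))) (by positivity) (‖D.proj‖ * ρ + 1)
      (by positivity)
    refine ⟨h₀, hh₀, fun h hh hhle N hN => ?_⟩
    obtain ⟨η, Y, hη0, hηstep, hηerr⟩ := hmain h hh hhle N hN
    have hmem : ∀ j ≤ N, (j : ℝ) * h ∈ Set.Icc 0 T := fun j hj =>
      ⟨by positivity, le_trans (by gcongr) hN⟩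
    have hηR : ∀ j ≤ N, ‖η j‖ ≤ R + 1 := fun j hj => by
      linarith [hR _ (hmem j hj), (hηerr j hj).2,
        norm_le_norm_add_norm_sub' (η j) (D.proj (z (j * h)))]
    have hz0 : D.lift lam (η 0) = z 0 := by
      rw [hη0]
      exact (hred 0 ⟨le_rfl, hT.le⟩).1
    constructor
    · refine ⟨fun j => D.lift lam (η j), hz0, fun j hj => ?_⟩
      obtain ⟨hY, hYnear, hη1, -⟩ := hηstep j hj
      refine ⟨_, (D.isConstrainedStep_iff hH hlam hidx M).2
        ⟨Y j, by rwa [D.proj_lift], fun i => ?_, rfl,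
          by rw [D.proj_lift]; exact congrArg _ hη1⟩⟩
      have h1 := (hYnear i).trans (min_le_left _ _)
      have h2 := (hYnear i).trans (min_le_right _ _)
      refine (hΛ.norm_sub_le ?_ ?_).trans ?_
      · rw [mem_closedBall_zero_iff]
        linarith [norm_le_norm_add_norm_sub' (Y j i) (η j), hηR j hj.le]
      · rw [mem_closedBall_zero_iff]
        linarith [hηR j hj.le]
      · rw [le_div_iff₀ (by positivity)] at h2
        nlinarith [norm_nonneg (Y j i - η j)]
    · intro ζ hζ0 hζ
      have hζη : ∀ j ≤ N, ζ j = D.lift lam (η j) := by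
        intro j
        induction j with
        | zero => intro _; rw [hζ0, hz0]
        | succ j ih =>
          intro hj
          obtain ⟨Z, hZ⟩ := hζ j hj
          obtain ⟨-, -, hη1, huniq⟩ := hηstep j hj
          rw [ih (by omega)] at hZ
          obtain ⟨Y', hY', hY'ρ, -, hζ1⟩ := (D.isConstrainedStep_iff hH hlam hidx M).1 hZ
          have hY'near := hnear hY'ρ
          rw [D.proj_lift] at hY' hζ1 hY'near
          rw [hζ1, huniq Y' hY' hY'near, hη1]
      intro j hj
      rw [hζη j hj, ← (hred _ (hmem j hj)).1, mul_assoc]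
      refine (hΛ.norm_sub_le ?_ ?_).trans (by gcongr; exact (hηerr j hj).1)
      · rw [mem_closedBall_zero_iff]
        linarith [hηR j hj]
      · rw [mem_closedBall_zero_iff]
        linarith [hR _ (hmem j hj)]
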